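/- Let $h$ be the binary entropy function (in bits), $0\le\varphi<1/2$, $\epsilon=2\varphi(1-\varphi)$ and $p=\varphi^2/(1-\epsilon)$. **Protocol $P_0$.** Alice has two secrets $x,y\in\mathbb F_2^m$, which are uniform and independent. $C_0$ is an $(n_0,k)$ binary linear code with an $(n_0-k)\times n_0$ parity check matrix $\mathbf H_0$; $\mathbf H_1$ is a uniformly random public $m\times n_0$ binary matrix, and $\mathbf H'=\begin{bmatrix}\mathbf H_0\\ \mathbf H_1\end{bmatrix}$. Alice sends $2n_0$ uniform random bits $r_i$, each one twice, over a binary symmetric channel (BSC) of crossover probability $\varphi$ (so there are $4n_0$ channel uses); a received pair is accepted as a bit if its two symbols agree and is an erasure otherwise. Bob sends Alice a partition of $\{1,\dots,2n_0\}$ into two sets $I,J$ of size $n_0$. Alice permutes $I$ and $J$ uniformly at random and reveals the permutations, picks $\mathbf c_x,\mathbf c_y$ uniformly among the solutions of $\mathbf H'\mathbf c_x=(\mathbf 0,x)$ and $\mathbf H'\mathbf c_y=(\mathbf 0,y)$, and sends $\mathbf c_x+\mathbf r_I$ and $\mathbf c_y+\mathbf r_J$ noiselessly. An honest Bob who wants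 $x$ chooses for $I$ a random set of $n_0$ accepted indices (for $J$, if he wants $y$; any random set if there are fewer than $n_0$ accepted indices), adds his noisy version of $\mathbf r_I$ (resp. $\mathbf r_J$) to the corresponding string, decodes, and multiplies the result by $\mathbf H_1$. A dishonest Bob may choose the partition in any (randomized) way that depends on what he received and on $\mathbf H'$. Let $\mathcal O$ be all that Bob observes. The *noisier* secret is $x$ if $I$ contains at least as many erased indices as $J$, and $y$ otherwise. **Statement.** Let $C_0$ run through a sequence of codes, with decoders, that is capacity-achieving for the BSC of parameter $p$: $n_0\to\infty$, the rates $k/n_0$ tend to $1-h(p)$, and the decoding error probabilities (averaged over uniformly random codewords) tend to $0$. 1. Let $\varepsilon'>0$ and let $m\le n_0\epsilon[1-h(p)-\varepsilon']$ for all codes of the sequence. Then there is $\delta\to0$, independent of Bob's strategy, such that for all but a fraction $\delta$ of the matrices $\mathbf H_1$ every secret can be encoded (every system $\mathbf H'\mathbf c=(\mathbf 0,s)$ is solvable) and, for every strategy of Bob, the conditional Shannon entropy of the noisier secret, given the other secret and $\mathcal O$, is at least $m-\delta$. 2. Consequently every oblivious transfer rate below $$\mathcal R_0(\varphi)=\varphi(1-\varphi)\left(1-h\!\left(\frac{\varphi^2}{1-2\varphi(1-\varphi)}\right)\right)$$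 is achieved: for every $R<\mathcal R_0(\varphi)$ one can choose the lengths $m$ such that the ratio $2m/(4n_0)$ is eventually larger than $R$, the conclusion of 1 holds, for every $\mathbf H_1$ for which all secrets can be encoded an honest Bob obtains the secret he wants with probability at least $1-\delta'$ with $\delta'\to0$, and the distribution of what Alice observes (when she follows the protocol and Bob is honest) does not depend on which secret Bob wants. 3. The function $\mathcal R_0$ has a maximum on $0<\varphi<1/2$, and its value is $\approx 0.108$ (it differs from $0.108$ by less than $0.0005$). -/

import Mathlib

open Filter Topology

namespace ObliviousTransfer

/-- Bit strings of length `n`, as vectors over the binary field. -/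
abbrev Bits (n : ℕ) : Type := Fin n → ZMod 2

/-! ### Channel parameters -/

/-- The binary entropy function in bits (Mathlib's `Real.binEntropy` is in nats). -/
noncomputable def binEnt (p : ℝ) : ℝ := Real.binEntropy p / Real.log 2

/-- `ε = 2 φ (1 - φ)`: the probability that a duplicated bit is received as an erasure. -/
noncomputable def erasureProb (φ : ℝ) : ℝ := 2 * φ * (1 - φ)

/-- `φ² / (1 - ε)`: the probability that an accepted bit is wrong. -/
noncomputable def flipProb (φ : ℝ) : ℝ := φ ^ 2 / (1 - erasureProb φ)

/-- The rate function `R₀(φ) = φ (1 - φ) (1 - binEnt (φ² / (1 - 2 φ (1 - φ))))`. -/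
noncomputable def rateP0 (φ : ℝ) : ℝ :=
  φ * (1 - φ) * (1 - binEnt (φ ^ 2 / (1 - 2 * φ * (1 - φ))))

/-- Transition probabilities of the binary symmetric channel with crossover probability `p`. -/
noncomputable def bsc (p : ℝ) (a b : ZMod 2) : ℝ := if b = a then 1 - p else p

/-! ### Finite probability spaces given by a mass function `w`, and Shannon entropy -/

/-- The probability of the event `A`. -/
noncomputable def prob {Ω : Type} [Fintype Ω] (w : Ω → ℝ) (A : Ω → Prop) : ℝ :=
  open Classical in ∑ ω : Ω, if A ω then w ω else 0

/-- The conditional Shannon entropy `H(U | W)`, in bits. -/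
noncomputable def condEntropy {Ω α β : Type} [Fintype Ω] [Fintype α] [Fintype β]
    (w : Ω → ℝ) (U : Ω → α) (W : Ω → β) : ℝ :=
  -∑ b : β, ∑ a : α, prob w (fun ω => U ω = a ∧ W ω = b) *
    Real.logb 2 (prob w (fun ω => U ω = a ∧ W ω = b) / prob w (fun ω => W ω = b))

/-! ### Codes -/

/-- `H₀` is a parity check matrix of the `(n, k)` linear code `C`: it has `n - k` rows and its
kernel is `C` (so its rows are linearly independent). -/
def IsParityCheck {n : ℕ} (C : Submodule (ZMod 2) (Bits n))
    (H₀ : Matrix (Fin (n - Module.finrank (ZMod 2) C)) (Fin n) (ZMod 2)) : Prop :=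
  ∀ c : Bits n, c ∈ C ↔ H₀.mulVec c = 0

/-- The decoding error probability of the decoder `D` when a uniformly random codeword of `C` is
sent over the binary symmetric channel with crossover probability `p`. -/
noncomputable def decodingError {n : ℕ} (p : ℝ) (C : Submodule (ZMod 2) (Bits n))
    (D : Bits n → Bits n) : ℝ :=
  open Classical in
  (1 / (Nat.card C : ℝ)) * ∑ c : C, ∑ z : Bits n,
    if D z ≠ (c : Bits n) then ∏ j, bsc p ((c : Bits n) j) (z j) else 0

/-- The sequence of linear codes `C i` of length `n i`, with the decoders `D i`, is
capacity-achieving over the binary symmetric channel with crossover probability `p`: the lengths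
tend to infinity, the rates tend to the capacity `1 - binEnt p`, and the decoding error probabilities
tend to `0`. -/
structure CapacityAchieving (p : ℝ) (n : ℕ → ℕ) (C : ∀ i, Submodule (ZMod 2) (Bits (n i)))
    (D : ∀ i, Bits (n i) → Bits (n i)) : Prop where
  length : Tendsto n atTop atTop
  rate : Tendsto (fun i => (Module.finrank (ZMod 2) (C i) : ℝ) / (n i : ℝ)) atTop (𝓝 (1 - binEnt p))
  error : Tendsto (fun i => decodingError p (C i) (D i)) atTop (𝓝 0)

/-! ### The protocol -/

/-- What Bob receives when `2 n` pairs of bits are sent over the noisy channel. -/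
abbrev Received (n : ℕ) : Type := Fin (2 * n) → ZMod 2 × ZMod 2

/-- A set `I` of `n` of the `2 n` indices; it stands for the partition `(I, J)`, `J = Iᶜ`. -/
abbrev Halving (n : ℕ) : Type := {I : Finset (Fin (2 * n)) // I.card = n}

/-- The complementary half: the partition `(J, I)`. -/
def Halving.swap {n : ℕ} (I : Halving n) : Halving n :=
  ⟨(I : Finset (Fin (2 * n)))ᶜ, by rw [Finset.card_compl, Fintype.card_fin, I.2]; omega⟩

/-- The indices in `I` in the order `σ` chosen by Alice. -/
def Halving.index {n : ℕ} (I : Halving n) (σ : Equiv.Perm (Fin n)) (j : Fin n) : Fin (2 * n) :=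
  (I : Finset (Fin (2 * n))).orderEmbOfFin I.2 (σ j)

/-- The number of erased symbols (pairs received as `(0,1)` or `(1,0)`) with index in `I`. -/
def Halving.erasures {n : ℕ} (I : Halving n) (z : Received n) : ℕ :=
  ((I : Finset (Fin (2 * n))).filter (fun i => (z i).1 ≠ (z i).2)).card

/-- All that happens in one execution of the protocol. -/
structure Run (n m : ℕ) where
  /-- Alice's first secret -/
  x : Bits m
  /-- Alice's second secret -/
  y : Bits m
  /-- the random bits that Alice sends, each of them twice, over the noisy channel -/
  r : Bits (2 * n)
  /-- the pairs that Bob receives -/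
  z : Received n
  /-- Bob's partition: `I` goes with the secret `x`, its complement `J` with the secret `y` -/
  I : Halving n
  /-- Alice's permutation of `I` -/
  σ : Equiv.Perm (Fin n)
  /-- Alice's permutation of `J` -/
  τ : Equiv.Perm (Fin n)
  /-- the codeword that carries `x` -/
  cx : Bits n
  /-- the codeword that carries `y` -/
  cy : Bits n

noncomputable instance (n m : ℕ) : Fintype (Run n m) :=
  Fintype.ofInjective
    (β := Bits m × Bits m × Bits (2 * n) × Received n × Halving n × Equiv.Perm (Fin n) ×
      Equiv.Perm (Fin n) × Bits n × Bits n)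
    (fun ω => (ω.x, ω.y, ω.r, ω.z, ω.I, ω.σ, ω.τ, ω.cx, ω.cy))
    (by
      rintro ⟨⟩ ⟨⟩ hω
      simpa only [Prod.mk.injEq, Run.mk.injEq] using hω)

namespace Run

variable {n m : ℕ}

/-- The string `r_I`, in Alice's order. -/
def rI (ω : Run n m) : Bits n := fun j => ω.r (ω.I.index ω.σ j)

/-- The string `r_J`, in Alice's order. -/
def rJ (ω : Run n m) : Bits n := fun j => ω.r (ω.I.swap.index ω.τ j)

/-- Bob's version `r'_I` of `r_I`. -/
def rI' (ω : Run n m) : Bits n := fun j => (ω.z (ω.I.index ω.σ j)).1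

/-- Bob's version `r'_J` of `r_J`. -/
def rJ' (ω : Run n m) : Bits n := fun j => (ω.z (ω.I.swap.index ω.τ j)).1

/-- What Bob observes: the received pairs, the partition, the two permutations, and the two
strings `c_x + r_I` and `c_y + r_J`. -/
def bobView (ω : Run n m) :
    Received n × Halving n × Equiv.Perm (Fin n) × Equiv.Perm (Fin n) × Bits n × Bits n :=
  (ω.z, ω.I, ω.σ, ω.τ, ω.cx + ω.rI, ω.cy + ω.rJ)

/-- What Alice observes: everything but the output of the noisy channel. -/
def aliceView (ω : Run n m) :
    Bits m × Bits m × Bits (2 * n) × Halving n × Equiv.Perm (Fin n) × Equiv.Perm (Fin n) ×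
      Bits n × Bits n :=
  (ω.x, ω.y, ω.r, ω.I, ω.σ, ω.τ, ω.cx, ω.cy)

/-- The secret that is sent over the noisier of the two virtual channels, i.e. that goes with the
half containing at least as many erased symbols as the other. -/
def noisySecret (ω : Run n m) : Bits m :=
  if ω.I.swap.erasures ω.z ≤ ω.I.erasures ω.z then ω.x else ω.y

/-- The other secret. -/
def otherSecret (ω : Run n m) : Bits m :=
  if ω.I.swap.erasures ω.z ≤ ω.I.erasures ω.z then ω.y else ω.x

/-- Bob's output when he asks for `x` (`wantsX = true`) or for `y` (`wantsX = false`): he decodes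
`(c_x + r_I) + r'_I`, resp. `(c_y + r_J) + r'_J`, with `D` and multiplies the result by `H₁`. -/
def output (D : Bits n → Bits n) (H₁ : Matrix (Fin m) (Fin n) (ZMod 2)) (wantsX : Bool)
    (ω : Run n m) : Bits m :=
  if wantsX then H₁.mulVec (D ((ω.cx + ω.rI) + ω.rI')) else H₁.mulVec (D ((ω.cy + ω.rJ) + ω.rJ'))

/-- The secret that Bob asks for. -/
def wanted (wantsX : Bool) (ω : Run n m) : Bits m := if wantsX then ω.x else ω.y

end Run

/-- `c` solves `H' c = (0, s)`, where `H'` is made of the rows of `H₀` and of `H₁`. -/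
def Encodes {a n m : ℕ} (H₀ : Matrix (Fin a) (Fin n) (ZMod 2)) (H₁ : Matrix (Fin m) (Fin n) (ZMod 2))
    (s : Bits m) (c : Bits n) : Prop :=
  (Matrix.fromRows H₀ H₁).mulVec c = Sum.elim (fun _ => 0) s

/-- Every secret can be encoded (for a parity check matrix `H₀`: the matrix `H'` has full row
rank), so that the protocol can be executed with `H'`. -/
def WellPosed {a n m : ℕ} (H₀ : Matrix (Fin a) (Fin n) (ZMod 2))
    (H₁ : Matrix (Fin m) (Fin n) (ZMod 2)) : Prop :=
  ∀ s : Bits m, ∃ c : Bits n, Encodes H₀ H₁ s c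

/-- The probability that Alice picks `c`, uniformly among all codewords that encode `s`. -/
noncomputable def pickProb {a n m : ℕ} (H₀ : Matrix (Fin a) (Fin n) (ZMod 2))
    (H₁ : Matrix (Fin m) (Fin n) (ZMod 2)) (s : Bits m) (c : Bits n) : ℝ :=
  open Classical in
  if Encodes H₀ H₁ s c then 1 / (Nat.card {c' : Bits n // Encodes H₀ H₁ s c'} : ℝ) else 0

/-- A (randomized, arbitrary) strategy of Bob: his choice of the partition, given what he received
over the noisy channel. The partition is the only message that Bob sends. -/
abbrev BobStrategy (n : ℕ) : Type := Received n → PMF (Halving n)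

/-- The joint law of all that happens, when the noisy channel is a binary symmetric channel with
crossover probability `φ`, the secrets `x`, `y` are independent and uniform, Alice follows the
protocol, and Bob chooses the partition according to `bob`. -/
noncomputable def runLaw {a n m : ℕ} (φ : ℝ) (H₀ : Matrix (Fin a) (Fin n) (ZMod 2))
    (H₁ : Matrix (Fin m) (Fin n) (ZMod 2)) (bob : BobStrategy n) (ω : Run n m) : ℝ :=
  (1 / 2) ^ m * (1 / 2) ^ m * (1 / 2) ^ (2 * n) *
    (∏ i, bsc φ (ω.r i) (ω.z i).1 * bsc φ (ω.r i) (ω.z i).2) *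
    (bob ω.z ω.I).toReal *
    (1 / (n.factorial : ℝ)) * (1 / (n.factorial : ℝ)) *
    pickProb H₀ H₁ ω.x ω.cx * pickProb H₀ H₁ ω.y ω.cy

/-- The `n`-element sets of successfully received (non-erased) indices. -/
def goodHalves {n : ℕ} (z : Received n) : Finset (Halving n) :=
  Finset.univ.filter (fun G => ∀ i ∈ (G : Finset (Fin (2 * n))), (z i).1 = (z i).2)

/-- The good half that an honest Bob picks: uniform among the `n`-element sets of successfully
received indices; if fewer than `n` indices are successfully received, uniform among all sets. -/
noncomputable def honestHalf {n : ℕ} (z : Received n) : PMF (Halving n) :=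
  open Classical in
  if hz : (goodHalves z).Nonempty then PMF.uniformOfFinset (goodHalves z) hz
  else PMF.uniformOfFinset Finset.univ
    (by
      obtain ⟨I, -, hI⟩ := Finset.exists_subset_card_eq
        (show n ≤ (Finset.univ : Finset (Fin (2 * n))).card by
          rw [Finset.card_univ, Fintype.card_fin]; omega)
      exact ⟨⟨I, hI⟩, Finset.mem_univ _⟩)

/-- Honest Bob: the good half is `I` if he wants `x`, and `J` if he wants `y`. -/
noncomputable def honestBob {n : ℕ} (wantsX : Bool) : BobStrategy n :=
  fun z => if wantsX then honestHalf z else (honestHalf z).map Halving.swap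

/-! ### Properties of a sequence of instances of the protocol -/

/-- Bob, whatever his strategy, obtains a vanishing amount of information on one of the two
secrets: up to a vanishing fraction of the matrices `H₁`, the protocol can be executed with `H₁`
and, for every strategy of Bob (which may depend on `H₁`), the entropy of the noisier secret given
the other one and all that Bob observes is within a vanishing quantity of its maximum `m`. -/
def SecretFromBob (φ : ℝ) (n a m : ℕ → ℕ)
    (H₀ : ∀ i, Matrix (Fin (a i)) (Fin (n i)) (ZMod 2)) : Prop :=
  ∃ δ : ℕ → ℝ, Tendsto δ atTop (𝓝 0) ∧ ∀ i,
    (1 - δ i) * (Nat.card (Matrix (Fin (m i)) (Fin (n i)) (ZMod 2)) : ℝ) ≤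
      (Nat.card {H₁ : Matrix (Fin (m i)) (Fin (n i)) (ZMod 2) //
        WellPosed (H₀ i) H₁ ∧ ∀ bob : BobStrategy (n i),
          (m i : ℝ) - δ i ≤ condEntropy (runLaw φ (H₀ i) H₁ bob) Run.noisySecret
            (fun ω => (ω.otherSecret, ω.bobView))} : ℝ)

/-- An honest Bob who uses the decoders `D i` obtains the secret that he wants with probability
tending to `1`. -/
def CorrectForBob (φ : ℝ) (n a m : ℕ → ℕ)
    (H₀ : ∀ i, Matrix (Fin (a i)) (Fin (n i)) (ZMod 2))
    (D : ∀ i, Bits (n i) → Bits (n i)) : Prop :=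
  ∃ δ : ℕ → ℝ, Tendsto δ atTop (𝓝 0) ∧ ∀ i,
    ∀ H₁ : Matrix (Fin (m i)) (Fin (n i)) (ZMod 2), WellPosed (H₀ i) H₁ → ∀ wantsX : Bool,
      1 - δ i ≤ prob (runLaw φ (H₀ i) H₁ (honestBob wantsX))
        (fun ω => ω.output (D i) H₁ wantsX = ω.wanted wantsX)

/-- The law of what Alice observes does not depend on which secret an honest Bob wants. -/
def HiddenFromAlice (φ : ℝ) (n a m : ℕ → ℕ)
    (H₀ : ∀ i, Matrix (Fin (a i)) (Fin (n i)) (ZMod 2)) : Prop :=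
  ∀ i, ∀ H₁ : Matrix (Fin (m i)) (Fin (n i)) (ZMod 2), ∀ v,
    prob (runLaw φ (H₀ i) H₁ (honestBob true)) (fun ω => ω.aliceView = v) =
      prob (runLaw φ (H₀ i) H₁ (honestBob false)) (fun ω => ω.aliceView = v)

end ObliviousTransfer

open ObliviousTransfer

/-! Given the pair received at an index, the bit sent there is the first received symbol plus a
noise bit: a fair coin if the pair is an erasure, a bit equal to 1 with probability `flipProb φ`
otherwise (`pairLaw_eq`). A uniform secret followed by a uniform solution of its system is a uniform
codeword of `C`, and the secret is its image under `H₁`. So each half is a uniform codeword seen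
through a channel with a known erasure pattern, and the secret is a random linear hash of that
codeword. Given the received pairs, the partition and the permutations, the two halves are
independent (`prob_view`), hence knowing the other secret does not help Bob.

The entropy missing from `m` is a sum of relative entropies to the uniform law (`deficit`), bounded
by the leftover hash lemma (`Universal.sum_deficit_le`) once atypical noise is split off. With `e`
erasures and `a = n - e` accepted bits, a codeword and a typical output have joint mass about `2^(-k
- e - a h(p))`; the `2^n` outputs and `2^m` hash values turn this into `2^(m - k + a (1 - h(p)))`.
The noisier half has about `n ε` erasures or more, so `k ≈ n (1 - h(p))` and the bound on `m` make
the exponent at most about `-n ε ε'`.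

Bob may choose the partition knowing `H₁`, so one matrix must resist all erasure patterns at once.
Alice's permutations average over all patterns with equally many erasures: only `n + 1` averages
matter (`avgDeficit_congr`), and Markov's inequality with a union bound suffices
(`card_bad_hash_le`).

Correctness holds because `ε < 1/2`: with high probability `n` accepted indices exist, and on such a
half the decoder sees exactly a uniform codeword after a BSC of parameter `p` (`halfSum_decoded`).
Alice learns nothing, since honest Bob's choice depends only on which pairs agree, and exchanging
the noise of the two halves preserves the channel law (`sum_bsc_honest`). The maximum of the rate
exists by compactness and is located by elementary logarithm bounds in the odds `φ / (1 - φ)`. -/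

namespace ObliviousTransfer

/-! ### The relative entropy to the uniform law -/

section Deficit

variable {α : Type} [Fintype α]

/-- For a nonnegative mass function `f` on `α`: the total mass of `f` times the relative entropy, in
bits, of the normalization of `f` to the uniform law on `α`. -/
noncomputable def deficit (f : α → ℝ) : ℝ :=
  ∑ a, f a * Real.logb 2 (Fintype.card α * f a / ∑ a', f a')

lemma deficit_const_mul (K : ℝ) (f : α → ℝ) : deficit (fun a => K * f a) = K * deficit f := by
  rcases eq_or_ne K 0 with rfl | hK
  · simp [deficit]
  · unfold deficit
    rw [Finset.mul_sum]
    refine Finset.sum_congr rfl fun a _ => ?_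
    rw [← Finset.mul_sum, mul_left_comm, mul_div_mul_left _ _ hK, mul_assoc]

/-- This is `log t ≤ t - 1` at `t = y / x`. The condition on zeros is absolute continuity: without
it, `x / 0 = 0` would make the right side vanish. -/
lemma mul_le_mul_logb {x y : ℝ} (hx : 0 ≤ x) (hy : 0 ≤ y) (hxy : y = 0 → x = 0) :
    (x - y) / Real.log 2 ≤ x * Real.logb 2 (x / y) := by
  have hl : 0 < Real.log 2 := Real.log_pos one_lt_two
  rw [Real.logb, ← mul_div_assoc]
  refine div_le_div_of_nonneg_right ?_ hl.le
  rcases hx.eq_or_lt with rfl | hx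
  · simp; exact hy
  have hy' : 0 < y := lt_of_le_of_ne hy fun h => hx.ne' (hxy h.symm)
  have := Real.log_le_sub_one_of_pos (div_pos hy' hx)
  rw [Real.log_div hy'.ne' hx.ne'] at this
  rw [Real.log_div hx.ne' hy'.ne']
  have h2 : x * (y / x) = y := by field_simp
  nlinarith

lemma deficit_nonneg {f : α → ℝ} (hf : ∀ a, 0 ≤ f a) : 0 ≤ deficit f := by
  have hl : 0 < Real.log 2 := Real.log_pos one_lt_two
  rcases isEmpty_or_nonempty α with h | h
  · simp [deficit]
  have hM : (0 : ℝ) < Fintype.card α := by exact_mod_cast Fintype.card_pos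
  set F := ∑ a, f a with hF
  have hF0 : 0 ≤ F := Finset.sum_nonneg fun a _ => hf a
  calc (0 : ℝ) = ∑ a, (f a - F / Fintype.card α) / Real.log 2 := by
        rw [← Finset.sum_div, Finset.sum_sub_distrib, ← hF]
        simp [hM.ne', mul_div_cancel₀]
    _ ≤ deficit f := by
        refine Finset.sum_le_sum fun a _ => ?_
        have := mul_le_mul_logb (hf a) (div_nonneg hF0 hM.le) (fun h0 => by
          have : F = 0 := by simpa [hM.ne'] using h0
          exact (Finset.sum_eq_zero_iff_of_nonneg fun a _ => hf a).1 this a (Finset.mem_univ a))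
        rwa [div_div_eq_mul_div, mul_comm (f a) (Fintype.card α : ℝ)] at this

/-- No point carries more than the total mass, so each logarithm is at most that of the cardinality.
This is the price paid for atypical mass. -/
lemma deficit_le_logb_card_mul {f : α → ℝ} (hf : ∀ a, 0 ≤ f a) :
    deficit f ≤ Real.logb 2 (Fintype.card α) * ∑ a, f a := by
  unfold deficit
  rw [Finset.mul_sum]
  refine Finset.sum_le_sum fun a _ => ?_
  rcases (hf a).eq_or_lt with h | h
  · simp [← h]
  have hM : (0 : ℝ) < Fintype.card α := by exact_mod_cast Fintype.card_pos_iff.2 ⟨a⟩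
  have hle : f a ≤ ∑ a', f a' := Finset.single_le_sum (fun a _ => hf a) (Finset.mem_univ a)
  have hF : 0 < ∑ a', f a' := h.trans_le hle
  rw [mul_comm]
  refine mul_le_mul_of_nonneg_right ?_ h.le
  refine Real.logb_le_logb_of_le one_lt_two (by positivity) ?_
  rw [div_le_iff₀ hF]
  exact mul_le_mul_of_nonneg_left hle hM.le

/-- The log-sum inequality: both terms are bounded below by tangents at the common ratio `r`, whose
linear parts cancel. -/
lemma log_sum_two {x y X Y : ℝ} (hx : 0 ≤ x) (hy : 0 ≤ y) (hX : 0 ≤ X) (hY : 0 ≤ Y)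
    (hxX : X = 0 → x = 0) (hyY : Y = 0 → y = 0) :
    (x + y) * Real.logb 2 ((x + y) / (X + Y)) ≤
      x * Real.logb 2 (x / X) + y * Real.logb 2 (y / Y) := by
  have hl : 0 < Real.log 2 := Real.log_pos one_lt_two
  rcases hx.eq_or_lt with rfl | hx
  · rcases hy.eq_or_lt with rfl | hy
    · simp
    have hY' : 0 < Y := lt_of_le_of_ne hY fun h => hy.ne' (hyY h.symm)
    simp only [zero_add, zero_mul]
    refine mul_le_mul_of_nonneg_left ?_ hy.le
    refine Real.logb_le_logb_of_le one_lt_two (by positivity) ?_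
    exact div_le_div_of_nonneg_left hy.le hY' (by linarith)
  have hX' : 0 < X := lt_of_le_of_ne hX fun h => hx.ne' (hxX h.symm)
  rcases hy.eq_or_lt with rfl | hy
  · simp only [add_zero, zero_mul]
    refine mul_le_mul_of_nonneg_left ?_ hx.le
    refine Real.logb_le_logb_of_le one_lt_two (by positivity) ?_
    exact div_le_div_of_nonneg_left hx.le hX' (by linarith)
  have hY' : 0 < Y := lt_of_le_of_ne hY fun h => hy.ne' (hyY h.symm)
  set r := (x + y) / (X + Y) with hr
  have hr0 : 0 < r := by positivity
  have h1 := mul_le_mul_logb hx.le (mul_nonneg hX'.le hr0.le) (by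
    intro h; exact absurd h (by positivity))
  have h2 := mul_le_mul_logb hy.le (mul_nonneg hY'.le hr0.le) (by
    intro h; exact absurd h (by positivity))
  have e1 : Real.logb 2 (x / (X * r)) = Real.logb 2 (x / X) - Real.logb 2 r := by
    rw [← div_div, Real.logb_div (by positivity) hr0.ne']
  have e2 : Real.logb 2 (y / (Y * r)) = Real.logb 2 (y / Y) - Real.logb 2 r := by
    rw [← div_div, Real.logb_div (by positivity) hr0.ne']
  rw [e1] at h1
  rw [e2] at h2
  have h3 : (x - X * r) / Real.log 2 + (y - Y * r) / Real.log 2 = 0 := by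
    rw [← add_div, hr]
    have : x - X * ((x + y) / (X + Y)) + (y - Y * ((x + y) / (X + Y))) = 0 := by
      field_simp; ring
    rw [this, zero_div]
  nlinarith

/-- Convexity of relative entropy together with homogeneity: the log-sum inequality at each point.
It allows a law to be split into a typical and an atypical part. -/
lemma deficit_add_le {f g : α → ℝ} (hf : ∀ a, 0 ≤ f a) (hg : ∀ a, 0 ≤ g a) :
    deficit (fun a => f a + g a) ≤ deficit f + deficit g := by
  unfold deficit
  rw [← Finset.sum_add_distrib]
  refine Finset.sum_le_sum fun a _ => ?_
  have hM : (0 : ℝ) < Fintype.card α := by exact_mod_cast Fintype.card_pos_iff.2 ⟨a⟩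
  have key : ∀ (h : α → ℝ), (∀ a, 0 ≤ h a) → (∑ a', h a') / (Fintype.card α : ℝ) = 0 → h a = 0 := by
    intro h hh h0
    have : ∑ a', h a' = 0 := by simpa [hM.ne'] using h0
    exact (Finset.sum_eq_zero_iff_of_nonneg fun a _ => hh a).1 this a (Finset.mem_univ a)
  have := log_sum_two (hf a) (hg a)
    (div_nonneg (Finset.sum_nonneg fun a _ => hf a) hM.le)
    (div_nonneg (Finset.sum_nonneg fun a _ => hg a) hM.le) (key f hf) (key g hg)
  rw [Finset.sum_add_distrib]
  rw [← add_div, div_div_eq_mul_div, div_div_eq_mul_div, div_div_eq_mul_div] at this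
  simpa only [mul_comm _ (Fintype.card α : ℝ)] using this

/-- Again `log t ≤ t - 1`. The resulting `χ²`-distance involves only collision probabilities, which
can be averaged over the hash functions. -/
lemma deficit_le_chiSq {f : α → ℝ} (hf : ∀ a, 0 ≤ f a) :
    deficit f ≤ (Fintype.card α * (∑ a, f a ^ 2) / (∑ a, f a) - ∑ a, f a) / Real.log 2 := by
  have hl : 0 < Real.log 2 := Real.log_pos one_lt_two
  unfold deficit
  set F := ∑ a, f a with hF
  rw [Finset.mul_sum, Finset.sum_div, hF, ← Finset.sum_sub_distrib, Finset.sum_div, ← hF]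
  refine Finset.sum_le_sum fun a _ => ?_
  rcases (hf a).eq_or_lt with h | h
  · simp [← h]
  have hM : (0 : ℝ) < Fintype.card α := by exact_mod_cast Fintype.card_pos_iff.2 ⟨a⟩
  have hle : f a ≤ F := Finset.single_le_sum (fun a _ => hf a) (Finset.mem_univ a)
  have hF : 0 < F := h.trans_le hle
  rw [Real.logb, ← mul_div_assoc]
  refine div_le_div_of_nonneg_right ?_ hl.le
  have := Real.log_le_sub_one_of_pos (show 0 < Fintype.card α * f a / F by positivity)
  calc f a * Real.log (Fintype.card α * f a / F) ≤ f a * (Fintype.card α * f a / F - 1) :=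
        mul_le_mul_of_nonneg_left this h.le
    _ = _ := by ring

lemma deficit_add_le_chiSq {f g : α → ℝ} (hf : ∀ a, 0 ≤ f a) (hg : ∀ a, 0 ≤ g a) :
    deficit (fun a => f a + g a) ≤
      (Fintype.card α * (∑ a, f a ^ 2) / (∑ a, f a) - ∑ a, f a) / Real.log 2 +
        Real.logb 2 (Fintype.card α) * ∑ a, g a :=
  (deficit_add_le hf hg).trans (add_le_add (deficit_le_chiSq hf) (deficit_le_logb_card_mul hg))

/-- The conditional entropy in terms of the deficits of the joint mass function. -/
lemma condEntropy_eq {Ω β : Type} [Fintype Ω] [Fintype β] [Nonempty α] {w : Ω → ℝ}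
    (hw : ∀ ω, 0 ≤ w ω) (U : Ω → α) (W : Ω → β) :
    condEntropy w U W = Real.logb 2 (Fintype.card α) * ∑ ω, w ω -
      ∑ b, deficit fun a => prob w fun ω => U ω = a ∧ W ω = b := by
  classical
  have hM : (0 : ℝ) < Fintype.card α := by exact_mod_cast Fintype.card_pos
  have hsum : ∀ b, prob w (fun ω => W ω = b) = ∑ a, prob w fun ω => U ω = a ∧ W ω = b := by
    intro b
    unfold prob
    rw [Finset.sum_comm]
    refine Finset.sum_congr rfl fun ω _ => ?_
    by_cases h : W ω = b <;> simp [h]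
  have htot : ∑ ω, w ω = ∑ b, ∑ a, prob w fun ω => U ω = a ∧ W ω = b := by
    simp_rw [← hsum]
    unfold prob
    rw [Finset.sum_comm]
    refine Finset.sum_congr rfl fun ω _ => ?_
    simp
  unfold condEntropy deficit
  rw [htot, ← Finset.sum_neg_distrib, Finset.mul_sum, ← Finset.sum_sub_distrib]
  refine Finset.sum_congr rfl fun b _ => ?_
  rw [← hsum]
  set P := prob w (fun ω => W ω = b) with hP
  rw [← Finset.sum_neg_distrib, hP, hsum, Finset.mul_sum, ← Finset.sum_sub_distrib, ← hsum, ← hP]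
  refine Finset.sum_congr rfl fun a _ => ?_
  have h0 : ∀ a, 0 ≤ prob w fun ω => U ω = a ∧ W ω = b := fun a => by
    unfold prob
    refine Finset.sum_nonneg fun ω _ => ?_
    split_ifs
    exacts [hw ω, le_rfl]
  rcases (h0 a).eq_or_lt with h | h
  · simp only [← h, zero_mul, mul_zero, neg_zero, sub_zero]
  have hle : (prob w fun ω => U ω = a ∧ W ω = b) ≤ P := by
    rw [hP, hsum]
    exact Finset.single_le_sum (fun a _ => h0 a) (Finset.mem_univ a)
  have hP0 : 0 < P := h.trans_le hle
  rw [mul_div_assoc, Real.logb_mul hM.ne' (by positivity)]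
  ring

end Deficit

/-! ### The leftover hash lemma -/

section Hash

variable {α γ β 𝓗 : Type} [DecidableEq α] [Fintype γ] [Fintype β] [Fintype 𝓗]

/-- The image of the mass function `f` under the map `φ`. -/
def pushMass (φ : γ → α) (f : γ → ℝ) (a : α) : ℝ := ∑ c, if φ c = a then f c else 0

lemma pushMass_nonneg (φ : γ → α) {f : γ → ℝ} (hf : ∀ c, 0 ≤ f c) (a : α) : 0 ≤ pushMass φ f a :=
  Finset.sum_nonneg fun c _ => by split_ifs; exacts [hf c, le_rfl]

lemma pushMass_add (φ : γ → α) (f g : γ → ℝ) (a : α) :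
    pushMass φ (fun c => f c + g c) a = pushMass φ f a + pushMass φ g a := by
  unfold pushMass
  rw [← Finset.sum_add_distrib]
  refine Finset.sum_congr rfl fun c _ => ?_
  split_ifs <;> simp

variable [Fintype α]

lemma sum_pushMass (φ : γ → α) (f : γ → ℝ) : ∑ a, pushMass φ f a = ∑ c, f c := by
  unfold pushMass
  rw [Finset.sum_comm]
  simp

lemma sum_pushMass_sq (φ : γ → α) (f : γ → ℝ) :
    ∑ a, pushMass φ f a ^ 2 = ∑ c, ∑ c', if φ c = φ c' then f c * f c' else 0 := by
  unfold pushMass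
  simp_rw [sq, Finset.sum_mul_sum]
  rw [Finset.sum_comm]
  refine Finset.sum_congr rfl fun c _ => ?_
  rw [Finset.sum_comm]
  refine Finset.sum_congr rfl fun c' _ => ?_
  rw [Finset.sum_eq_single (φ c)]
  · simp [eq_comm]
  · intro b _ hb
    simp [hb.symm]
  · simp

/-- The family `hash` of functions is universal: two distinct points collide with probability at
most `1 / card α`. -/
def Universal (hash : 𝓗 → γ → α) : Prop :=
  ∀ c c', c ≠ c' → (Fintype.card α : ℝ) * (∑ h, if hash h c = hash h c' then (1 : ℝ) else 0) ≤
    Fintype.card 𝓗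

/-- Expanding the squares counts collisions. The diagonal pairs contribute at most `q` times the
mass; each pair of distinct points collides for at most a fraction `1 / card α` of the hash
functions. -/
lemma Universal.sum_sq_le {hash : 𝓗 → γ → α} (hu : Universal hash) {f : γ → ℝ}
    (hf : ∀ c, 0 ≤ f c) {q : ℝ} (hq : ∀ c, f c ≤ q) :
    Fintype.card α * ∑ h, ∑ a, pushMass (hash h) f a ^ 2 ≤
      Fintype.card 𝓗 * (Fintype.card α * q * (∑ c, f c) + (∑ c, f c) ^ 2) := by
  classical
  have h1 : ∑ h, ∑ a, pushMass (hash h) f a ^ 2 =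
      ∑ c, ∑ c', f c * f c' * ∑ h, (if hash h c = hash h c' then (1 : ℝ) else 0) := by
    simp_rw [sum_pushMass_sq, Finset.mul_sum]
    rw [Finset.sum_comm]
    refine Finset.sum_congr rfl fun c _ => ?_
    rw [Finset.sum_comm]
    simp
  have h2 : ∀ c c', Fintype.card α * (f c * f c' *
      ∑ h, (if hash h c = hash h c' then (1 : ℝ) else 0)) ≤
      Fintype.card 𝓗 * (f c * f c' + if c = c' then Fintype.card α * (f c * q) else 0) := by
    intro c c'
    by_cases h : c = c'
    · subst h
      simp only [if_true, Finset.sum_const, Finset.card_univ, nsmul_eq_mul, mul_one]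
      have := mul_le_mul_of_nonneg_left (hq c) (hf c)
      have h3 : 0 ≤ f c * f c := mul_self_nonneg _
      have h4 : (Fintype.card α : ℝ) * (f c * f c) ≤ f c * f c + Fintype.card α * (f c * q) := by
        have := mul_le_mul_of_nonneg_left this (Nat.cast_nonneg (α := ℝ) (Fintype.card α))
        linarith
      have := mul_le_mul_of_nonneg_left h4 (Nat.cast_nonneg (α := ℝ) (Fintype.card 𝓗))
      linarith
    · rw [if_neg h, add_zero, mul_left_comm, mul_comm (Fintype.card 𝓗 : ℝ)]
      exact mul_le_mul_of_nonneg_left (hu c c' h) (mul_nonneg (hf c) (hf c'))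
  rw [h1]
  simp_rw [Finset.mul_sum]
  simp_rw [Finset.mul_sum] at h2
  refine (Finset.sum_le_sum fun c _ => Finset.sum_le_sum fun c' _ => h2 c c').trans (le_of_eq ?_)
  simp_rw [← Finset.mul_sum, Finset.sum_add_distrib]
  rw [sq, Finset.sum_mul_sum]
  simp only [Finset.sum_ite_eq, Finset.mem_univ, if_true]
  simp_rw [← Finset.mul_sum, ← Finset.sum_mul]
  ring

/-- The leftover hash lemma for the `χ²`-distance. -/
lemma Universal.sum_chiSq_le {hash : 𝓗 → γ → α} (hu : Universal hash) {f : γ → ℝ}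
    (hf : ∀ c, 0 ≤ f c) {q : ℝ} (hq0 : 0 ≤ q) (hq : ∀ c, f c ≤ q) :
    ∑ h, (Fintype.card α * (∑ a, pushMass (hash h) f a ^ 2) / (∑ a, pushMass (hash h) f a) -
      ∑ a, pushMass (hash h) f a) ≤ Fintype.card 𝓗 * (Fintype.card α * q) := by
  simp_rw [sum_pushMass]
  set F := ∑ c, f c with hF
  have hF0 : 0 ≤ F := Finset.sum_nonneg fun c _ => hf c
  rcases hF0.eq_or_lt with h | h
  · rw [← h]; simp; positivity
  rw [Finset.sum_sub_distrib, ← Finset.sum_div, ← Finset.mul_sum, sub_le_iff_le_add,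
    div_le_iff₀ h]
  refine (hu.sum_sq_le hf hq).trans (le_of_eq ?_)
  simp only [Finset.sum_const, Finset.card_univ, nsmul_eq_mul]
  ring

/-- The leftover hash lemma: if the mass function `f + g` on `γ × β` has its part `f` bounded by `q`,
then a random hash value is nearly uniform given the second component. -/
lemma Universal.sum_deficit_le {hash : 𝓗 → γ → α} (hu : Universal hash) {f g : β → γ → ℝ}
    (hf : ∀ b c, 0 ≤ f b c) (hg : ∀ b c, 0 ≤ g b c) {q : ℝ} (hq0 : 0 ≤ q)
    (hq : ∀ b c, f b c ≤ q) :
    ∑ h, ∑ b, deficit (pushMass (hash h) fun c => f b c + g b c) ≤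
      Fintype.card 𝓗 * (Fintype.card β * (Fintype.card α * q) / Real.log 2 +
        Real.logb 2 (Fintype.card α) * ∑ b, ∑ c, g b c) := by
  have hl : 0 < Real.log 2 := Real.log_pos one_lt_two
  rw [Finset.sum_comm]
  have : ∀ b, ∑ h, deficit (pushMass (hash h) fun c => f b c + g b c) ≤
      Fintype.card 𝓗 * ((Fintype.card α * q) / Real.log 2 +
        Real.logb 2 (Fintype.card α) * ∑ c, g b c) := by
    intro b
    have h1 : ∀ h, deficit (pushMass (hash h) fun c => f b c + g b c) ≤
        (Fintype.card α * (∑ a, pushMass (hash h) (f b) a ^ 2) / (∑ a, pushMass (hash h) (f b) a) -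
          ∑ a, pushMass (hash h) (f b) a) / Real.log 2 +
        Real.logb 2 (Fintype.card α) * ∑ c, g b c := fun h => by
      rw [funext fun a => pushMass_add (hash h) (f b) (g b) a, ← sum_pushMass (hash h) (g b)]
      exact deficit_add_le_chiSq (pushMass_nonneg (hash h) (hf b))
        (pushMass_nonneg (hash h) (hg b))
    refine (Finset.sum_le_sum fun h _ => h1 h).trans ?_
    rw [Finset.sum_add_distrib, ← Finset.sum_div]
    simp only [Finset.sum_const, Finset.card_univ, nsmul_eq_mul]
    rw [mul_add, ← mul_div_assoc]
    exact add_le_add (div_le_div_of_nonneg_right (hu.sum_chiSq_le (hf b) hq0 (hq b)) hl.le) le_rfl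
  refine (Finset.sum_le_sum fun b _ => this b).trans (le_of_eq ?_)
  rw [← Finset.mul_sum, Finset.sum_add_distrib, ← Finset.mul_sum]
  simp only [Finset.sum_const, Finset.card_univ, nsmul_eq_mul]
  ring

end Hash

/-- Random binary matrices form a universal family of hash functions. -/
lemma universal_mulVec (n m : ℕ) :
    Universal fun (H : Matrix (Fin m) (Fin n) (ZMod 2)) (c : Bits n) => H.mulVec c := by
  classical
  intro c c' hc
  obtain ⟨j, hj⟩ := Function.ne_iff.1 (sub_ne_zero.2 hc)
  have hj1 : (c - c') j = 1 := by
    have : ∀ a : ZMod 2, a ≠ 0 → a = 1 := by decide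
    exact this _ hj
  -- Two points collide when `H` kills their difference. Evaluation at `c - c'` is additive and
  -- onto, so the colliding matrices form a subgroup of index `card (Bits m)`.
  let T : Matrix (Fin m) (Fin n) (ZMod 2) →+ Bits m :=
    { toFun := fun H => H.mulVec (c - c')
      map_zero' := by simp
      map_add' := fun A B => Matrix.add_mulVec A B _ }
  have hsurj : Function.Surjective T := by
    intro v
    refine ⟨Matrix.of fun i l => if l = j then v i else 0, ?_⟩
    funext i
    change ∑ l, (if l = j then v i else 0) * (c - c') l = v i
    simp only [ite_mul, zero_mul, Finset.sum_ite_eq', Finset.mem_univ, if_true, hj1, mul_one]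
  have h1 : Nat.card (Matrix (Fin m) (Fin n) (ZMod 2)) = Nat.card (Bits m) * Nat.card T.ker := by
    rw [AddSubgroup.card_eq_card_quotient_mul_card_addSubgroup T.ker]
    congr 1
    exact Nat.card_congr (QuotientAddGroup.quotientKerEquivOfSurjective T hsurj).toEquiv
  have h2 : (∑ H : Matrix (Fin m) (Fin n) (ZMod 2),
      if H.mulVec c = H.mulVec c' then (1 : ℝ) else 0) = Nat.card T.ker := by
    rw [Finset.sum_boole, Nat.card_eq_fintype_card, Fintype.card_subtype]
    congr 2
    ext H
    simp [T, AddMonoidHom.mem_ker, Matrix.mulVec_sub, sub_eq_zero]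
  change (Fintype.card (Bits m) : ℝ) * (∑ H : Matrix (Fin m) (Fin n) (ZMod 2),
      if H.mulVec c = H.mulVec c' then (1 : ℝ) else 0) ≤ _
  rw [h2, ← Nat.card_eq_fintype_card, ← Nat.card_eq_fintype_card, h1]
  push_cast
  exact le_rfl

lemma Universal.comp_injective {α γ γ' 𝓗 : Type} [Fintype α] [DecidableEq α] [Fintype 𝓗]
    {hash : 𝓗 → γ → α} (hu : Universal hash) {e : γ' → γ} (he : Function.Injective e) :
    Universal fun h c => hash h (e c) :=
  fun _ _ hc => hu _ _ (he.ne hc)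

/-! ### A Chernoff bound -/

/-- The product of `1 - x + x²/2` with the lower bound `1 + x + x²/2` of `exp x` is `1 + x⁴/4`. -/
lemma exp_neg_le_quadratic {x : ℝ} (hx : 0 ≤ x) : Real.exp (-x) ≤ 1 - x + x ^ 2 / 2 := by
  have h := Real.quadratic_le_exp_of_nonneg hx
  rw [Real.exp_neg, inv_le_iff_one_le_mul₀ (Real.exp_pos x)]
  have h0 : 0 ≤ 1 - x + x ^ 2 / 2 := by nlinarith [sq_nonneg (x - 1)]
  calc (1 : ℝ) ≤ (1 - x + x ^ 2 / 2) * (1 + x + x ^ 2 / 2) := by nlinarith [sq_nonneg (x ^ 2)]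
    _ ≤ _ := mul_le_mul_of_nonneg_left h h0

/-- A Chernoff bound for the lower tail of the number of occurrences of the independent events
`A j`, `j : ι`. -/
lemma chernoff_lower {ι α : Type} [Fintype ι] [DecidableEq ι] [Fintype α] {w : ι → α → ℝ}
    (hw : ∀ j a, 0 ≤ w j a) (hw1 : ∀ j, ∑ a, w j a = 1) (A : ι → α → Prop)
    [∀ j a, Decidable (A j a)] {q D N : ℝ}
    (hq : q ≤ ∑ j, ∑ a, if A j a then w j a else 0) (hD : 0 ≤ D) (hN : 0 < N)
    (hιN : (Fintype.card ι : ℝ) ≤ N) :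
    (∑ e : ι → α, if ((Finset.univ.filter fun j => A j (e j)).card : ℝ) < q - D
      then ∏ j, w j (e j) else 0) ≤ Real.exp (-(D ^ 2 / (2 * N))) := by
  -- This value minimizes the final exponent `-l D + N l² / 2`.
  set l : ℝ := D / N with hl
  have hl0 : 0 ≤ l := by positivity
  set Q : ι → ℝ := fun j => ∑ a, if A j a then w j a else 0 with hQ
  have hQ0 : ∀ j, 0 ≤ Q j := fun j => Finset.sum_nonneg fun a _ => by
    split_ifs; exacts [hw j a, le_rfl]
  have hQ1 : ∀ j, Q j ≤ 1 := fun j => by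
    rw [← hw1 j]
    refine Finset.sum_le_sum fun a _ => ?_
    split_ifs; exacts [le_rfl, hw j a]
  have h1 : ∀ e : ι → α, (if ((Finset.univ.filter fun j => A j (e j)).card : ℝ) < q - D
      then ∏ j, w j (e j) else 0) ≤
      Real.exp (l * (q - D)) * ∏ j, (w j (e j) * if A j (e j) then Real.exp (-l) else 1) := by
    intro e
    have hp : 0 ≤ ∏ j, w j (e j) := Finset.prod_nonneg fun j _ => hw j _
    have hc : ∏ j, (if A j (e j) then Real.exp (-l) else 1) =
        Real.exp (-(l * ((Finset.univ.filter fun j => A j (e j)).card : ℝ))) := by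
      rw [Finset.prod_ite, Finset.prod_const, Finset.prod_const_one, mul_one, ← Real.exp_nat_mul]
      congr 1; ring
    rw [Finset.prod_mul_distrib, hc, mul_left_comm, ← Real.exp_add]
    split_ifs with h
    · refine le_mul_of_one_le_right hp (Real.one_le_exp ?_)
      nlinarith
    · positivity
  refine (Finset.sum_le_sum fun e _ => h1 e).trans ?_
  rw [← Finset.mul_sum]
  have h2 : ∑ e : ι → α, ∏ j, (w j (e j) * if A j (e j) then Real.exp (-l) else 1) =
      ∏ j, ∑ a, w j a * if A j a then Real.exp (-l) else 1 := by
    rw [Finset.prod_univ_sum, Fintype.piFinset_univ]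
  have h3 : ∀ j, (∑ a, w j a * if A j a then Real.exp (-l) else 1) ≤
      Real.exp (-(Q j * l) + l ^ 2 / 2) := by
    intro j
    have : (∑ a, w j a * if A j a then Real.exp (-l) else 1) = 1 - Q j * (1 - Real.exp (-l)) := by
      have h5 : Q j * (1 - Real.exp (-l)) =
          ∑ a, (if A j a then w j a else 0) * (1 - Real.exp (-l)) := Finset.sum_mul _ _ _
      rw [h5, ← hw1 j, ← Finset.sum_sub_distrib]
      refine Finset.sum_congr rfl fun a _ => ?_
      rw [hw1 j]
      split_ifs <;> ring
    rw [this]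
    have h4 := exp_neg_le_quadratic hl0
    have h5 := Real.add_one_le_exp (-(Q j * l) + l ^ 2 / 2)
    have h6 : Q j * (l - l ^ 2 / 2) ≤ Q j * (1 - Real.exp (-l)) :=
      mul_le_mul_of_nonneg_left (by linarith) (hQ0 j)
    have h7 := mul_le_mul_of_nonneg_right (hQ1 j) (sq_nonneg l)
    nlinarith
  have h4 : ∏ j, (∑ a, w j a * if A j a then Real.exp (-l) else 1) ≤
      Real.exp (-(q * l) + N * (l ^ 2 / 2)) := by
    refine (Finset.prod_le_prod (fun j _ => Finset.sum_nonneg fun a _ => ?_)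
      fun j _ => h3 j).trans ?_
    · split_ifs
      · exact mul_nonneg (hw j a) (Real.exp_pos _).le
      · simpa using hw j a
    rw [← Real.exp_sum]
    refine Real.exp_le_exp.2 ?_
    rw [Finset.sum_add_distrib, Finset.sum_neg_distrib, ← Finset.sum_mul, Finset.sum_const,
      Finset.card_univ, nsmul_eq_mul]
    have := mul_le_mul_of_nonneg_right hιN (show 0 ≤ l ^ 2 / 2 by positivity)
    have := mul_le_mul_of_nonneg_right hq hl0
    linarith
  rw [h2]
  refine (mul_le_mul_of_nonneg_left h4 (Real.exp_pos _).le).trans ?_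
  rw [← Real.exp_add]
  refine Real.exp_le_exp.2 (le_of_eq ?_)
  rw [hl]
  field_simp
  ring

/-! ### The two virtual channels -/

lemma bsc_nonneg {p : ℝ} (h0 : 0 ≤ p) (h1 : p ≤ 1) (a b : ZMod 2) : 0 ≤ bsc p a b := by
  unfold bsc; split_ifs <;> linarith

lemma bsc_add (p : ℝ) (a b c : ZMod 2) : bsc p (a + c) (b + c) = bsc p a b := by
  simp [bsc]

/-- The joint law of a uniform bit and of the pair that is received when it is sent twice. -/
noncomputable def pairLaw (φ : ℝ) (r : ZMod 2) (w : ZMod 2 × ZMod 2) : ℝ :=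
  1 / 2 * (bsc φ r w.1 * bsc φ r w.2)

/-- The law of a received pair. -/
noncomputable def pairMass (φ : ℝ) (w : ZMod 2 × ZMod 2) : ℝ :=
  if w.1 ≠ w.2 then erasureProb φ / 2 else (1 - erasureProb φ) / 2

/-- The law of the noise on an erased (`true`) or on an accepted (`false`) bit. -/
noncomputable def noiseLaw (p : ℝ) (erased : Bool) (e : ZMod 2) : ℝ :=
  if erased then 1 / 2 else bsc p 0 e

/-- Whether a received pair is an erasure. -/
def isErased (w : ZMod 2 × ZMod 2) : Bool := w.1 ≠ w.2

lemma isErased_iff {w : ZMod 2 × ZMod 2} : isErased w = true ↔ w.1 ≠ w.2 :=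
  decide_eq_true_iff

lemma sum_zmod_two (f : ZMod 2 → ℝ) : ∑ a, f a = f 0 + f 1 := Fin.sum_univ_two f

lemma forall_zmod_two {P : ZMod 2 → Prop} (h0 : P 0) (h1 : P 1) (a : ZMod 2) : P a := by
  have : ∀ a : ZMod 2, a = 0 ∨ a = 1 := by decide
  rcases this a with rfl | rfl <;> assumption

lemma add_self_zmod_two (a : ZMod 2) : a + a = 0 := CharTwo.add_self_eq_zero a

lemma bits_add_self {n : ℕ} (a : Bits n) : a + a = 0 := funext fun j => add_self_zmod_two (a j)

lemma bits_add_eq_iff {n : ℕ} (a b c : Bits n) : a + b = c ↔ b = c + a := by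
  constructor
  · rintro rfl; rw [add_right_comm, bits_add_self, zero_add]
  · rintro rfl; rw [add_left_comm, bits_add_self, add_zero]

section Params

variable {φ : ℝ} (h0 : 0 ≤ φ) (h1 : φ < 1 / 2)

include h0 h1

lemma erasureProb_nonneg : 0 ≤ erasureProb φ := by unfold erasureProb; nlinarith
omit h0 in
lemma erasureProb_lt_half : erasureProb φ < 1 / 2 := by
  unfold erasureProb; nlinarith [sq_nonneg (1 - 2 * φ)]
omit h0 in
lemma flipProb_nonneg : 0 ≤ flipProb φ := by
  have := erasureProb_lt_half h1
  unfold flipProb; exact div_nonneg (sq_nonneg _) (by linarith)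
omit h0 in
lemma flipProb_lt_half : flipProb φ < 1 / 2 := by
  have := erasureProb_lt_half h1
  unfold flipProb
  rw [div_lt_iff₀ (by linarith)]
  unfold erasureProb; nlinarith
lemma pairMass_nonneg (w : ZMod 2 × ZMod 2) : 0 ≤ pairMass φ w := by
  have := erasureProb_lt_half h1
  have := erasureProb_nonneg h0 h1
  unfold pairMass; split_ifs <;> linarith
lemma pairLaw_nonneg (r : ZMod 2) (w : ZMod 2 × ZMod 2) : 0 ≤ pairLaw φ r w := by
  unfold pairLaw
  have := bsc_nonneg h0 (by linarith) r w.1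
  have := bsc_nonneg h0 (by linarith) r w.2
  positivity
omit h0 in
lemma noiseLaw_nonneg (b : Bool) (e : ZMod 2) : 0 ≤ noiseLaw (flipProb φ) b e := by
  unfold noiseLaw
  have := flipProb_lt_half h1
  split_ifs
  · norm_num
  · exact bsc_nonneg (flipProb_nonneg h1) (by linarith) _ _

omit h0 in
-- Bayes' rule for one bit, from `(1 - ε) p = φ²`, `(1 - ε)(1 - p) = (1 - φ)²` and `ε / 2 = φ (1 -
-- φ)`. The noise depends on the received pair only through its being an erasure or not.
lemma pairLaw_eq (r : ZMod 2) (w : ZMod 2 × ZMod 2) :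
    pairLaw φ r w = pairMass φ w * noiseLaw (flipProb φ) (isErased w) (r + w.1) := by
  have h := erasureProb_lt_half h1
  have h2 : (1 - erasureProb φ) * flipProb φ = φ ^ 2 := by
    unfold flipProb; field_simp [show 1 - erasureProb φ ≠ 0 by linarith]
  have h3 : (1 - erasureProb φ) * (1 - flipProb φ) = (1 - φ) ^ 2 := by
    rw [mul_sub, h2]; unfold erasureProb; ring
  have h4 : erasureProb φ = 2 * φ * (1 - φ) := rfl
  obtain ⟨a, b⟩ := w
  revert r a b
  refine forall_zmod_two (forall_zmod_two (forall_zmod_two ?_ ?_) (forall_zmod_two ?_ ?_))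
    (forall_zmod_two (forall_zmod_two ?_ ?_) (forall_zmod_two ?_ ?_)) <;>
  simp [pairLaw, pairMass, noiseLaw, isErased, bsc, show (1 : ZMod 2) + 1 = 0 from rfl] <;>
  nlinarith

end Params

lemma sum_noiseLaw (p : ℝ) (b : Bool) : ∑ e, noiseLaw p b e = 1 := by
  rw [sum_zmod_two]
  cases b <;> simp [noiseLaw, bsc] ; norm_num

lemma sum_pairMass (φ : ℝ) : ∑ w, pairMass φ w = 1 := by
  rw [Fintype.sum_prod_type, sum_zmod_two, sum_zmod_two, sum_zmod_two]
  simp [pairMass]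
  ring

lemma sum_pi_prod {ι X : Type} [Fintype ι] [DecidableEq ι] [Fintype X] (f : ι → X → ℝ) :
    ∑ e : ι → X, ∏ j, f j (e j) = ∏ j, ∑ a, f j a := by
  rw [Finset.prod_univ_sum, Fintype.piFinset_univ]

lemma sum_prod_pairLaw {φ : ℝ} (h1 : φ < 1 / 2) {n : ℕ}
    (w : Fin n → ZMod 2 × ZMod 2) :
    ∑ r : Bits n, ∏ j, pairLaw φ (r j) (w j) = ∏ j, pairMass φ (w j) := by
  rw [sum_pi_prod fun j a => pairLaw φ a (w j)]
  refine Finset.prod_congr rfl fun j _ => ?_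
  simp_rw [pairLaw_eq h1]
  rw [← Finset.mul_sum]
  rw [Fintype.sum_equiv (Equiv.addRight (w j).1)
    (fun r => noiseLaw (flipProb φ) (isErased (w j)) (r + (w j).1))
    (noiseLaw (flipProb φ) (isErased (w j))) fun _ => rfl, sum_noiseLaw, mul_one]

/-! ### The two halves -/

section Halves

variable {n : ℕ} (I : Halving n) (σ τ : Equiv.Perm (Fin n))

lemma Halving.index_mem (j : Fin n) : I.index σ j ∈ (I : Finset (Fin (2 * n))) :=
  Finset.orderEmbOfFin_mem _ _ _

lemma Halving.swap_index_notMem (j : Fin n) : I.swap.index τ j ∉ (I : Finset (Fin (2 * n))) :=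
  Finset.mem_compl.1 (I.swap.index_mem τ j)

lemma Halving.index_injective : Function.Injective (I.index σ) :=
  (Finset.orderEmbOfFin _ I.2).injective.comp σ.injective

/-- The two halves, in Alice's order, make up all the indices. -/
noncomputable def Halving.sumEquiv : Fin n ⊕ Fin n ≃ Fin (2 * n) :=
  Equiv.ofBijective (Sum.elim (I.index σ) (I.swap.index τ)) <| by
    rw [Fintype.bijective_iff_injective_and_card]
    refine ⟨(I.index_injective σ).sumElim (I.swap.index_injective τ) fun a b h => ?_, ?_⟩
    · exact I.swap_index_notMem τ b (h ▸ I.index_mem σ a)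
    · simp [two_mul]

lemma Halving.prod_split {M : Type} [CommMonoid M] (G : Fin (2 * n) → M) :
    ∏ i, G i = (∏ j, G (I.index σ j)) * ∏ j, G (I.swap.index τ j) := by
  rw [← Fintype.prod_equiv (I.sumEquiv σ τ) (fun j => G (I.sumEquiv σ τ j)) G fun _ => rfl,
    Fintype.prod_sum_type]
  rfl

lemma Halving.sum_split {X : Type} [Fintype X] (F : (Fin n → X) → (Fin n → X) → ℝ) :
    ∑ r : Fin (2 * n) → X, F (fun j => r (I.index σ j)) (fun j => r (I.swap.index τ j)) =
      ∑ a, ∑ b, F a b := by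
  rw [← Fintype.sum_prod_type']
  exact Fintype.sum_equiv (((I.sumEquiv σ τ).symm.arrowCongr (Equiv.refl X)).trans
    (Equiv.sumArrowEquivProdArrow _ _ _)) _ _ fun r => rfl

lemma Halving.swap_swap : I.swap.swap = I := Subtype.ext (compl_compl _)

/-- The part of the received pairs that belongs to the half `I`, in Alice's order. -/
def Halving.part (z : Received n) : Fin n → ZMod 2 × ZMod 2 := fun j => z (I.index σ j)

lemma Halving.erasures_eq (z : Received n) :
    I.erasures z = (Finset.univ.filter fun j => isErased (I.part σ z j) = true).card := by
  unfold erasures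
  symm
  refine Finset.card_bij (fun j _ => I.index σ j) ?_ (fun a _ b _ h => I.index_injective σ h) ?_
  · intro j hj
    rw [Finset.mem_filter] at hj ⊢
    exact ⟨I.index_mem σ j, isErased_iff.1 hj.2⟩
  · intro i hi
    rw [Finset.mem_filter] at hi
    obtain ⟨j, rfl⟩ := (I.sumEquiv σ σ).surjective i
    rcases j with j | j
    · refine ⟨j, Finset.mem_filter.2 ⟨Finset.mem_univ _, ?_⟩, rfl⟩
      exact isErased_iff.2 hi.2
    · exact absurd hi.1 (I.swap_index_notMem σ j)

lemma Halving.erasures_add (z : Received n) :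
    I.erasures z + I.swap.erasures z =
      (Finset.univ.filter fun i => isErased (z i) = true).card := by
  unfold erasures
  rw [← Finset.card_union_of_disjoint, ← Finset.filter_union]
  · simp [swap, isErased]
  · exact Finset.disjoint_filter_filter disjoint_compl_right

end Halves

/-! ### The joint law of an execution -/

/-- The factor of the joint law that belongs to one of the halves, integrated against `A`. -/
noncomputable def halfSum {a n m : ℕ} (φ : ℝ) (H₀ : Matrix (Fin a) (Fin n) (ZMod 2))
    (H₁ : Matrix (Fin m) (Fin n) (ZMod 2)) (w : Fin n → ZMod 2 × ZMod 2)
    (A : Bits m → Bits n → Bits n → ℝ) : ℝ :=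
  ∑ u, ∑ c, ∑ r : Bits n,
    (1 / 2) ^ m * pickProb H₀ H₁ u c * (∏ j, pairLaw φ (r j) (w j)) * A u c r

/-- A run as a tuple. -/
def runEquiv (n m : ℕ) : Run n m ≃
    Received n × Halving n × Equiv.Perm (Fin n) × Equiv.Perm (Fin n) × Bits m × Bits m ×
      Bits n × Bits n × Bits (2 * n) where
  toFun ω := (ω.z, ω.I, ω.σ, ω.τ, ω.x, ω.y, ω.cx, ω.cy, ω.r)
  invFun t := ⟨t.2.2.2.2.1, t.2.2.2.2.2.1, t.2.2.2.2.2.2.2.2, t.1, t.2.1, t.2.2.1, t.2.2.2.1,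
    t.2.2.2.2.2.2.1, t.2.2.2.2.2.2.2.1⟩
  left_inv _ := rfl
  right_inv _ := rfl

lemma sum_run {n m : ℕ} (F : Run n m → ℝ) :
    ∑ ω, F ω = ∑ z, ∑ I, ∑ σ, ∑ τ, ∑ x, ∑ y, ∑ cx, ∑ cy, ∑ r, F ⟨x, y, r, z, I, σ, τ, cx, cy⟩ := by
  rw [Fintype.sum_equiv (runEquiv n m) F (fun t => F ((runEquiv n m).symm t))
    fun ω => by rw [Equiv.symm_apply_apply]]
  simp only [Fintype.sum_prod_type]
  rfl

section Law

variable {a n m : ℕ} (φ : ℝ) (H₀ : Matrix (Fin a) (Fin n) (ZMod 2))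
  (H₁ : Matrix (Fin m) (Fin n) (ZMod 2)) (bob : BobStrategy n)

/-- The joint law is a mixture of product laws. -/
lemma sum_runLaw_mul
    (A B : Received n → Halving n → Equiv.Perm (Fin n) → Equiv.Perm (Fin n) →
      Bits m → Bits n → Bits n → ℝ) :
    ∑ ω : Run n m, runLaw φ H₀ H₁ bob ω *
      (A ω.z ω.I ω.σ ω.τ ω.x ω.cx ω.rI * B ω.z ω.I ω.σ ω.τ ω.y ω.cy ω.rJ) =
    ∑ z, ∑ I, ∑ σ, ∑ τ, ((bob z I).toReal * (1 / (n.factorial : ℝ)) * (1 / (n.factorial : ℝ))) *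
      (halfSum φ H₀ H₁ (I.part σ z) (A z I σ τ) *
        halfSum φ H₀ H₁ (I.swap.part τ z) (B z I σ τ)) := by
  rw [sum_run]
  refine Finset.sum_congr rfl fun z _ => Finset.sum_congr rfl fun I _ =>
    Finset.sum_congr rfl fun σ _ => Finset.sum_congr rfl fun τ _ => ?_
  have key : ∀ x y cx cy, ∑ r, runLaw φ H₀ H₁ bob ⟨x, y, r, z, I, σ, τ, cx, cy⟩ *
      (A z I σ τ x cx (fun j => r (I.index σ j)) *
        B z I σ τ y cy (fun j => r (I.swap.index τ j))) =
      ((bob z I).toReal * (1 / (n.factorial : ℝ)) * (1 / (n.factorial : ℝ))) *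
      ((∑ r, (1 / 2) ^ m * pickProb H₀ H₁ x cx * (∏ j, pairLaw φ (r j) (I.part σ z j)) *
          A z I σ τ x cx r) *
        (∑ r, (1 / 2) ^ m * pickProb H₀ H₁ y cy * (∏ j, pairLaw φ (r j) (I.swap.part τ z j)) *
          B z I σ τ y cy r)) := by
    intro x y cx cy
    -- The bits `r` split into two independent strings, one for each half in Alice's order, so the
    -- sum over `r` is a product.
    rw [Finset.sum_mul_sum, ← I.sum_split σ τ, Finset.mul_sum]
    refine Finset.sum_congr rfl fun r _ => ?_
    simp only [runLaw, pairLaw, Halving.part, Finset.prod_mul_distrib, Finset.prod_const,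
      Finset.card_univ, Fintype.card_fin]
    rw [I.prod_split σ τ fun i => bsc φ (r i) (z i).1, I.prod_split σ τ fun i => bsc φ (r i) (z i).2,
      two_mul n, pow_add]
    ring
  refine (Finset.sum_congr rfl fun x _ => Finset.sum_congr rfl fun y _ => Finset.sum_congr rfl
    fun cx _ => Finset.sum_congr rfl fun cy _ => key x y cx cy).trans ?_
  simp_rw [← Finset.mul_sum]
  congr 1
  unfold halfSum
  rw [Finset.sum_mul_sum]
  refine Finset.sum_congr rfl fun x _ => Finset.sum_congr rfl fun y _ => ?_
  rw [Finset.sum_mul]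

lemma sum_bob (z : Received n) : ∑ I, (bob z I).toReal = 1 := by
  rw [← ENNReal.toReal_sum fun I _ => (bob z).apply_ne_top I, ← tsum_fintype (L := .unconditional _),
    PMF.tsum_coe, ENNReal.toReal_one]

lemma sum_perm (c : ℝ) : ∑ _σ : Equiv.Perm (Fin n), 1 / (n.factorial : ℝ) * c = c := by
  rw [Finset.sum_const, Finset.card_univ, Fintype.card_perm, Fintype.card_fin, nsmul_eq_mul,
    ← mul_assoc, mul_one_div_cancel (by exact_mod_cast n.factorial_ne_zero), one_mul]

end Law

/-! ### Codewords and secrets -/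

section Encode

variable {n m : ℕ} {C : Submodule (ZMod 2) (Bits n)}
  {H₀ : Matrix (Fin (n - Module.finrank (ZMod 2) C)) (Fin n) (ZMod 2)}
  {H₁ : Matrix (Fin m) (Fin n) (ZMod 2)}

lemma IsParityCheck.encodes_iff (h : IsParityCheck C H₀) (u : Bits m) (c : Bits n) :
    Encodes H₀ H₁ u c ↔ c ∈ C ∧ H₁.mulVec c = u := by
  unfold Encodes
  rw [Matrix.fromRows_mulVec, Sum.elim_eq_iff, h c]
  rfl

lemma IsParityCheck.wellPosed_iff (h : IsParityCheck C H₀) :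
    WellPosed H₀ H₁ ↔ ∀ u : Bits m, ∃ c : C, H₁.mulVec (c : Bits n) = u := by
  unfold WellPosed
  simp_rw [h.encodes_iff]
  refine forall_congr' fun u => ⟨fun ⟨c, hc, hu⟩ => ⟨⟨c, hc⟩, hu⟩, fun ⟨c, hu⟩ => ⟨c, c.2, hu⟩⟩

lemma card_bits (m : ℕ) : Fintype.card (Bits m) = 2 ^ m := by simp [ZMod.card]

/-- The solution sets of the different secrets partition `C` and are translates of one another. -/
lemma IsParityCheck.card_encodes (h : IsParityCheck C H₀) (hwp : WellPosed H₀ H₁) (u : Bits m) :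
    2 ^ m * Nat.card {c // Encodes H₀ H₁ u c} = Nat.card C := by
  classical
  have h1 : ∀ v : Bits m, Nat.card {c // Encodes H₀ H₁ v c} =
      Nat.card {c // Encodes H₀ H₁ u c} := by
    intro v
    obtain ⟨d, hd⟩ := hwp (v + u)
    have hd' := (h.encodes_iff (v + u) d).1 hd
    refine Nat.card_congr ((Equiv.addRight d).subtypeEquiv fun c => ?_)
    rw [h.encodes_iff, h.encodes_iff, Equiv.coe_addRight, C.add_mem_iff_left hd'.1,
      Matrix.mulVec_add, hd'.2, bits_add_eq_iff, add_comm v u, add_right_inj, eq_comm (a := v)]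
  have h2 : Nat.card C = ∑ v : Bits m, Nat.card {c // Encodes H₀ H₁ v c} := by
    rw [← Nat.card_sigma]
    refine Nat.card_congr ⟨fun c => ⟨H₁.mulVec c, c, (h.encodes_iff _ _).2 ⟨c.2, rfl⟩⟩,
      fun t => ⟨t.2, ((h.encodes_iff _ _).1 t.2.2).1⟩, fun c => rfl, ?_⟩
    rintro ⟨v, c, hc⟩
    obtain ⟨h3, rfl⟩ := (h.encodes_iff _ _).1 hc
    rfl
  rw [h2, Finset.sum_congr rfl fun v _ => h1 v, Finset.sum_const, Finset.card_univ, card_bits,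
    smul_eq_mul]

/-- Drawing a secret and then one of its codewords amounts to drawing a uniform codeword of `C` and
hashing it. This makes secrecy a question of privacy amplification. -/
lemma IsParityCheck.pickProb_eq (h : IsParityCheck C H₀) (hwp : WellPosed H₀ H₁) (u : Bits m)
    (c : Bits n) [Decidable (c ∈ C ∧ H₁.mulVec c = u)] :
    (1 / 2) ^ m * pickProb H₀ H₁ u c =
      if c ∈ C ∧ H₁.mulVec c = u then 1 / (Nat.card C : ℝ) else 0 := by
  unfold pickProb
  rw [← h.card_encodes hwp u]
  simp_rw [h.encodes_iff]
  split_ifs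
  · push_cast
    rw [one_div_pow, one_div_mul_one_div]
  · rw [mul_zero]

lemma IsParityCheck.sum_pickProb_mul (h : IsParityCheck C H₀) (hwp : WellPosed H₀ H₁)
    [Fintype C] (F : Bits m → Bits n → ℝ) :
    ∑ u, ∑ c, (1 / 2) ^ m * pickProb H₀ H₁ u c * F u c =
      ∑ c : C, 1 / (Nat.card C : ℝ) * F (H₁.mulVec c) c := by
  classical
  rw [Finset.sum_comm]
  have : ∀ c, ∑ u, (1 / 2) ^ m * pickProb H₀ H₁ u c * F u c =
      if c ∈ C then 1 / (Nat.card C : ℝ) * F (H₁.mulVec c) c else 0 := by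
    intro c
    simp_rw [h.pickProb_eq hwp]
    by_cases hc : c ∈ C <;> simp [hc]
  simp_rw [this]
  rw [← Finset.sum_filter]
  exact (Finset.sum_subtype _ (by simp) (fun c => 1 / (Nat.card C : ℝ) * F (H₁.mulVec c) c))

end Encode

/-! ### The virtual channel seen through the hash function -/

section Virtual

variable {n m : ℕ} (C : Submodule (ZMod 2) (Bits n)) [Fintype C] (p : ℝ)
  (H₁ : Matrix (Fin m) (Fin n) (ZMod 2))

/-- The joint law of a uniform codeword and of the output `s` of the channel whose noise has the
erasure pattern `E`. -/
noncomputable def codeMass (E : Fin n → Bool) (s : Bits n) (c : C) : ℝ :=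
  1 / (Nat.card C : ℝ) * ∏ j, noiseLaw p (E j) (s j + (c : Bits n) j)

/-- The deficit of the hash value of a uniform codeword, given the output of the channel whose
noise has the erasure pattern `E`. -/
noncomputable def hashDeficit (E : Fin n → Bool) : ℝ :=
  ∑ s, deficit (pushMass (fun c : C => H₁.mulVec (c : Bits n)) (codeMass C p E s))

variable {C p}

omit [Fintype C] in
lemma codeMass_nonneg (hp : ∀ b e, 0 ≤ noiseLaw p b e) (E : Fin n → Bool) (s : Bits n) (c : C) :
    0 ≤ codeMass C p E s c :=
  mul_nonneg (by positivity) (Finset.prod_nonneg fun j _ => hp _ _)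

lemma sum_noise_shift (c : Bits n) (F : Bits n → ℝ) :
    ∑ s : Bits n, F (s + c) = ∑ s, F s :=
  Fintype.sum_equiv (Equiv.addRight c) _ _ fun _ => rfl

lemma sum_prod_noiseLaw (E : Fin n → Bool) : ∑ s : Bits n, ∏ j, noiseLaw p (E j) (s j) = 1 := by
  rw [sum_pi_prod fun j => noiseLaw p (E j)]
  simp [sum_noiseLaw]

lemma sum_codeMass (E : Fin n → Bool) : ∑ s, ∑ c : C, codeMass C p E s c = 1 := by
  rw [Finset.sum_comm]
  unfold codeMass
  have : ∀ c : C, ∑ s : Bits n, 1 / (Nat.card C : ℝ) *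
      ∏ j, noiseLaw p (E j) (s j + (c : Bits n) j) = 1 / (Nat.card C : ℝ) := by
    intro c
    rw [← Finset.mul_sum]
    have := sum_noise_shift (c : Bits n) fun s => ∏ j, noiseLaw p (E j) (s j)
    simp only [Pi.add_apply] at this
    rw [this, sum_prod_noiseLaw, mul_one]
  simp_rw [this]
  rw [Finset.sum_const, Finset.card_univ, nsmul_eq_mul, ← Nat.card_eq_fintype_card]
  exact mul_one_div_cancel (by exact_mod_cast Nat.card_pos.ne')

lemma hashDeficit_nonneg (hp : ∀ b e, 0 ≤ noiseLaw p b e) (E : Fin n → Bool) :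
    0 ≤ hashDeficit C p H₁ E :=
  Finset.sum_nonneg fun s _ => deficit_nonneg (pushMass_nonneg _ (codeMass_nonneg hp E s))

lemma logb_card_bits (m : ℕ) : Real.logb 2 (Fintype.card (Bits m)) = m := by
  rw [card_bits]
  push_cast
  rw [← Real.rpow_natCast, Real.logb_rpow (by norm_num) (by norm_num)]

/-- The fallback bound for the rare received strings with too few erasures. -/
lemma hashDeficit_le (hp : ∀ b e, 0 ≤ noiseLaw p b e) (E : Fin n → Bool) :
    hashDeficit C p H₁ E ≤ m := by
  unfold hashDeficit
  refine (Finset.sum_le_sum fun s _ => deficit_le_logb_card_mul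
    (pushMass_nonneg _ (codeMass_nonneg hp E s))).trans (le_of_eq ?_)
  rw [← Finset.mul_sum]
  simp_rw [sum_pushMass]
  rw [sum_codeMass, logb_card_bits, mul_one]

end Virtual

/-! ### The entropy of the noisier secret -/

section Secrecy

variable {a n m : ℕ} (φ : ℝ) (H₀ : Matrix (Fin a) (Fin n) (ZMod 2))
  (H₁ : Matrix (Fin m) (Fin n) (ZMod 2))

/-- The joint law of the received pairs of one half, of the string that Alice sends for this half,
and of the secret. -/
noncomputable def halfLaw (w : Fin n → ZMod 2 × ZMod 2) (s : Bits n) (u : Bits m) : ℝ :=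
  halfSum φ H₀ H₁ w fun u' c r => if u' = u ∧ c + r = s then 1 else 0

lemma halfSum_zero (w : Fin n → ZMod 2 × ZMod 2) : halfSum φ H₀ H₁ w (fun _ _ _ => 0) = 0 := by
  simp [halfSum]

/-- For fixed received pairs, partition and permutations the law is a product over the two halves;
Bob's strategy enters only as a constant factor. -/
lemma prob_view (bob : BobStrategy n) (u v : Bits m) (z : Received n) (I : Halving n)
    (σ τ : Equiv.Perm (Fin n)) (s t : Bits n) :
    prob (runLaw φ H₀ H₁ bob) (fun ω => ω.x = u ∧ ω.y = v ∧ ω.bobView = (z, I, σ, τ, s, t)) =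
      ((bob z I).toReal * (1 / (n.factorial : ℝ)) * (1 / (n.factorial : ℝ))) *
        (halfLaw φ H₀ H₁ (I.part σ z) s u * halfLaw φ H₀ H₁ (I.swap.part τ z) t v) := by
  classical
  have h := sum_runLaw_mul φ H₀ H₁ bob
    (fun z' I' σ' τ' u' c r => if z' = z ∧ I' = I ∧ σ' = σ ∧ τ' = τ then
      (if u' = u ∧ c + r = s then 1 else 0) else 0)
    (fun _ _ _ _ v' c r => if v' = v ∧ c + r = t then 1 else 0)
  rw [Finset.sum_eq_single z, Finset.sum_eq_single I, Finset.sum_eq_single σ,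
    Finset.sum_eq_single τ] at h
  · simp only [and_self, if_true] at h
    unfold halfLaw
    rw [← h]
    unfold prob
    refine Finset.sum_congr rfl fun ω _ => ?_
    simp only [Run.bobView, Prod.mk.injEq]
    split_ifs <;> simp_all
  · intro b _ hb
    simp [hb, halfSum_zero]
  · simp
  · intro b _ hb
    simp [hb, halfSum_zero]
  · simp
  · intro b _ hb
    simp [hb, halfSum_zero]
  · simp
  · intro b _ hb
    simp [hb, halfSum_zero]
  · simp

lemma sum_halfLaw_eq_halfSum (w : Fin n → ZMod 2 × ZMod 2) :
    ∑ s, ∑ u, halfLaw φ H₀ H₁ w s u = halfSum φ H₀ H₁ w fun _ _ _ => 1 := by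
  unfold halfLaw halfSum
  have h : ∀ s u, (∑ u', ∑ c, ∑ r : Bits n,
      (1 / 2) ^ m * pickProb H₀ H₁ u' c * (∏ j, pairLaw φ (r j) (w j)) *
        (if u' = u ∧ c + r = s then (1 : ℝ) else 0)) = ∑ c, ∑ r : Bits n,
      (1 / 2) ^ m * pickProb H₀ H₁ u c * (∏ j, pairLaw φ (r j) (w j)) *
        (if c + r = s then (1 : ℝ) else 0) := by
    intro s u
    rw [Finset.sum_eq_single u]
    · simp
    · intro b _ hb; simp [hb]
    · simp
  simp_rw [h]
  rw [Finset.sum_comm]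
  refine Finset.sum_congr rfl fun u _ => ?_
  rw [Finset.sum_comm]
  refine Finset.sum_congr rfl fun c _ => ?_
  rw [Finset.sum_comm]
  refine Finset.sum_congr rfl fun r _ => ?_
  simp

end Secrecy

/-! ### One half as a hashed codeword behind a noisy channel -/

section HalfLaw

variable {n m : ℕ} {φ : ℝ} {C : Submodule (ZMod 2) (Bits n)} [Fintype C]
  {H₀ : Matrix (Fin (n - Module.finrank (ZMod 2) C)) (Fin n) (ZMod 2)}
  {H₁ : Matrix (Fin m) (Fin n) (ZMod 2)}

lemma IsParityCheck.halfSum_eq (h : IsParityCheck C H₀) (hwp : WellPosed H₀ H₁)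
    (w : Fin n → ZMod 2 × ZMod 2) (A : Bits m → Bits n → Bits n → ℝ) :
    halfSum φ H₀ H₁ w A = ∑ c : C, 1 / (Nat.card C : ℝ) *
      ∑ r : Bits n, (∏ j, pairLaw φ (r j) (w j)) * A (H₁.mulVec c) c r := by
  rw [← h.sum_pickProb_mul hwp fun u c => ∑ r : Bits n, (∏ j, pairLaw φ (r j) (w j)) * A u c r]
  unfold halfSum
  simp_rw [Finset.mul_sum, mul_assoc]

lemma IsParityCheck.halfSum_one (h1 : φ < 1 / 2) (h : IsParityCheck C H₀) (hwp : WellPosed H₀ H₁)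
    (w : Fin n → ZMod 2 × ZMod 2) :
    halfSum φ H₀ H₁ w (fun _ _ _ => 1) = ∏ j, pairMass φ (w j) := by
  rw [h.halfSum_eq hwp]
  simp_rw [mul_one, sum_prod_pairLaw h1]
  rw [Finset.sum_const, Finset.card_univ, nsmul_eq_mul, ← Nat.card_eq_fintype_card, ← mul_assoc,
    mul_one_div_cancel (by exact_mod_cast Nat.card_pos.ne'), one_mul]

/-- From `s = c + r`, the noise `r + w.1` equals `s + w.1 + c`. Apart from their probability, the
received bits act only through the erasure pattern and a translation of `s`. -/
lemma IsParityCheck.halfLaw_eq (h1 : φ < 1 / 2) (h : IsParityCheck C H₀) (hwp : WellPosed H₀ H₁)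
    (w : Fin n → ZMod 2 × ZMod 2) (s : Bits n) (u : Bits m) :
    halfLaw φ H₀ H₁ w s u = (∏ j, pairMass φ (w j)) *
      pushMass (fun c : C => H₁.mulVec (c : Bits n))
        (codeMass C (flipProb φ) (fun j => isErased (w j)) (s + fun j => (w j).1)) u := by
  unfold halfLaw
  rw [h.halfSum_eq hwp, pushMass, Finset.mul_sum]
  refine Finset.sum_congr rfl fun c _ => ?_
  split_ifs with hu
  · have : ∀ r : Bits n, (if H₁.mulVec (c : Bits n) = u ∧ (c : Bits n) + r = s then (1 : ℝ) else 0) =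
        if r = s + c then 1 else 0 := by
      intro r
      simp only [hu, true_and, bits_add_eq_iff]
    simp_rw [this]
    simp only [mul_ite, mul_one, mul_zero, Finset.sum_ite_eq', Finset.mem_univ, if_true]
    unfold codeMass
    rw [mul_left_comm]
    congr 1
    rw [← Finset.prod_mul_distrib]
    refine Finset.prod_congr rfl fun j _ => ?_
    rw [pairLaw_eq h1]
    simp only [Pi.add_apply]
    rw [add_right_comm]
  · simp [hu]

/-- The translation of `s` disappears in the sum over `s`. -/
lemma IsParityCheck.sum_deficit_halfLaw (h1 : φ < 1 / 2) (h : IsParityCheck C H₀)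
    (hwp : WellPosed H₀ H₁) (w : Fin n → ZMod 2 × ZMod 2) :
    ∑ s, deficit (halfLaw φ H₀ H₁ w s) =
      (∏ j, pairMass φ (w j)) * hashDeficit C (flipProb φ) H₁ fun j => isErased (w j) := by
  have : ∀ s, deficit (halfLaw φ H₀ H₁ w s) = (∏ j, pairMass φ (w j)) *
      deficit (pushMass (fun c : C => H₁.mulVec (c : Bits n))
        (codeMass C (flipProb φ) (fun j => isErased (w j)) (s + fun j => (w j).1))) := fun s => by
    rw [← deficit_const_mul]
    exact congrArg deficit (funext fun u => h.halfLaw_eq h1 hwp w s u)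
  simp_rw [this]
  rw [← Finset.mul_sum, sum_noise_shift (fun j => (w j).1) fun s =>
    deficit (pushMass (fun c : C => H₁.mulVec (c : Bits n))
        (codeMass C (flipProb φ) (fun j => isErased (w j)) s))]
  rfl

lemma IsParityCheck.sum_runLaw (h1 : φ < 1 / 2) (h : IsParityCheck C H₀)
    (hwp : WellPosed H₀ H₁) (bob : BobStrategy n) : ∑ ω, runLaw φ H₀ H₁ bob ω = 1 := by
  have h2 := sum_runLaw_mul φ H₀ H₁ bob (fun _ _ _ _ _ _ _ => 1) (fun _ _ _ _ _ _ _ => 1)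
  simp only [mul_one] at h2
  rw [h2]
  simp_rw [h.halfSum_one h1 hwp]
  have h3 : ∀ (z : Received n) (I : Halving n) (σ τ : Equiv.Perm (Fin n)),
      (∏ j, pairMass φ (I.part σ z j)) * (∏ j, pairMass φ (I.swap.part τ z j)) =
        ∏ i, pairMass φ (z i) := fun z I σ τ =>
    (I.prod_split σ τ fun i => pairMass φ (z i)).symm
  have h4 : ∀ (z : Received n) (I : Halving n), ∑ _σ : Equiv.Perm (Fin n),
      ∑ _τ : Equiv.Perm (Fin n), (bob z I).toReal * (1 / (n.factorial : ℝ)) *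
        (1 / (n.factorial : ℝ)) * (∏ i, pairMass φ (z i)) =
      (bob z I).toReal * ∏ i, pairMass φ (z i) := by
    intro z I
    rw [← sum_perm (n := n) ((bob z I).toReal * ∏ i, pairMass φ (z i))]
    refine Finset.sum_congr rfl fun σ _ => ?_
    rw [← sum_perm (n := n) (1 / (n.factorial : ℝ) * ((bob z I).toReal * ∏ i, pairMass φ (z i)))]
    exact Finset.sum_congr rfl fun τ _ => by ring
  simp_rw [h3, h4, ← Finset.sum_mul, sum_bob, one_mul]
  rw [sum_pi_prod fun _ => pairMass φ]
  simp [sum_pairMass]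

end HalfLaw

lemma pickProb_nonneg {a n m : ℕ} (H₀ : Matrix (Fin a) (Fin n) (ZMod 2))
    (H₁ : Matrix (Fin m) (Fin n) (ZMod 2)) (s : Bits m) (c : Bits n) :
    0 ≤ pickProb H₀ H₁ s c := by
  unfold pickProb; split_ifs <;> positivity

lemma runLaw_nonneg {a n m : ℕ} {φ : ℝ} (h0 : 0 ≤ φ) (h1 : φ < 1 / 2)
    (H₀ : Matrix (Fin a) (Fin n) (ZMod 2)) (H₁ : Matrix (Fin m) (Fin n) (ZMod 2))
    (bob : BobStrategy n) (ω : Run n m) : 0 ≤ runLaw φ H₀ H₁ bob ω := by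
  have h2 : 0 ≤ ∏ i, bsc φ (ω.r i) (ω.z i).1 * bsc φ (ω.r i) (ω.z i).2 :=
    Finset.prod_nonneg fun i _ => mul_nonneg (bsc_nonneg h0 (by linarith) _ _)
      (bsc_nonneg h0 (by linarith) _ _)
  have h3 := pickProb_nonneg H₀ H₁ ω.x ω.cx
  have h4 := pickProb_nonneg H₀ H₁ ω.y ω.cy
  unfold runLaw
  have h5 := (bob ω.z ω.I).toReal_nonneg
  positivity

lemma prob_congr {Ω : Type} [Fintype Ω] (w : Ω → ℝ) {A B : Ω → Prop} (h : ∀ ω, A ω ↔ B ω) :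
    prob w A = prob w B := by
  rw [funext fun ω => propext (h ω)]

/-- The index of the sum that defines the conditional entropy, rearranged. -/
def viewEquiv (n m : ℕ) : Bits m × Received n × Halving n × Equiv.Perm (Fin n) ×
    Equiv.Perm (Fin n) × Bits n × Bits n ≃ Received n × Halving n × Equiv.Perm (Fin n) ×
    Equiv.Perm (Fin n) × Bits m × Bits n × Bits n where
  toFun t := (t.2.1, t.2.2.1, t.2.2.2.1, t.2.2.2.2.1, t.1, t.2.2.2.2.2)
  invFun t := (t.2.2.2.2.1, t.1, t.2.1, t.2.2.1, t.2.2.2.1, t.2.2.2.2.2)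
  left_inv _ := rfl
  right_inv _ := rfl

lemma sum_view {n m : ℕ} (F : Bits m × Received n × Halving n × Equiv.Perm (Fin n) ×
    Equiv.Perm (Fin n) × Bits n × Bits n → ℝ) :
    ∑ b, F b = ∑ z, ∑ I, ∑ σ, ∑ τ, ∑ v, ∑ s, ∑ t, F (v, z, I, σ, τ, s, t) := by
  rw [Fintype.sum_equiv (viewEquiv n m) F (fun t => F ((viewEquiv n m).symm t))
    fun ω => by rw [Equiv.symm_apply_apply]]
  simp only [Fintype.sum_prod_type]
  rfl

/-! ### From one half to Bob's whole view -/

section Secrecy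

variable {n m : ℕ} {φ : ℝ} {C : Submodule (ZMod 2) (Bits n)} [Fintype C]
  {H₀ : Matrix (Fin (n - Module.finrank (ZMod 2) C)) (Fin n) (ZMod 2)}
  {H₁ : Matrix (Fin m) (Fin n) (ZMod 2)}

lemma IsParityCheck.sum_halfLaw (h1 : φ < 1 / 2) (h : IsParityCheck C H₀) (hwp : WellPosed H₀ H₁)
    (w : Fin n → ZMod 2 × ZMod 2) :
    ∑ v, ∑ t, halfLaw φ H₀ H₁ w t v = ∏ j, pairMass φ (w j) := by
  rw [Finset.sum_comm, sum_halfLaw_eq_halfSum, h.halfSum_one h1 hwp]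

/-- The total deficit for the part of the observations with given received pairs, partition and
permutations. -/
lemma IsParityCheck.sum_deficit_view (h1 : φ < 1 / 2) (h : IsParityCheck C H₀)
    (hwp : WellPosed H₀ H₁) (bob : BobStrategy n) (z : Received n) (I : Halving n)
    (σ τ : Equiv.Perm (Fin n)) :
    ∑ v, ∑ s, ∑ t, deficit (fun u => prob (runLaw φ H₀ H₁ bob) fun ω =>
        ω.noisySecret = u ∧ (ω.otherSecret, ω.bobView) = (v, z, I, σ, τ, s, t)) =
      (bob z I).toReal * (1 / (n.factorial : ℝ)) * (1 / (n.factorial : ℝ)) *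
        ((∏ i, pairMass φ (z i)) * if I.swap.erasures z ≤ I.erasures z then
          hashDeficit C (flipProb φ) H₁ (fun j => isErased (I.part σ z j)) else
          hashDeficit C (flipProb φ) H₁ (fun j => isErased (I.swap.part τ z j))) := by
  set K := (bob z I).toReal * (1 / (n.factorial : ℝ)) * (1 / (n.factorial : ℝ)) with hK
  have hP : ∏ i, pairMass φ (z i) =
      (∏ j, pairMass φ (I.part σ z j)) * (∏ j, pairMass φ (I.swap.part τ z j)) :=
    I.prod_split σ τ fun i => pairMass φ (z i)
  clear_value K
  split_ifs with hc
  -- The factor of the other half does not involve `u`, so homogeneity of `deficit` takes it out;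
  -- summed over `v` and `t` it is the mass of the pairs received in that half.
  · have h2 : ∀ v s t, deficit (fun u => prob (runLaw φ H₀ H₁ bob) fun ω =>
        ω.noisySecret = u ∧ (ω.otherSecret, ω.bobView) = (v, z, I, σ, τ, s, t)) =
        K * (deficit (halfLaw φ H₀ H₁ (I.part σ z) s) *
          halfLaw φ H₀ H₁ (I.swap.part τ z) t v) := by
      intro v s t
      rw [mul_comm (deficit _), ← mul_assoc, ← deficit_const_mul]
      refine congrArg deficit (funext fun u => ?_)
      rw [mul_assoc, mul_comm (halfLaw φ H₀ H₁ (I.swap.part τ z) t v), hK, ← prob_view]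
      refine prob_congr _ fun ω => ?_
      simp only [Run.noisySecret, Run.otherSecret, Run.bobView, Prod.mk.injEq]
      constructor
      · rintro ⟨h3, h4, rfl, rfl, h5⟩
        rw [if_pos hc] at h3 h4
        exact ⟨h3, h4, rfl, rfl, h5⟩
      · rintro ⟨h3, h4, rfl, rfl, h5⟩
        rw [if_pos hc, if_pos hc]
        exact ⟨h3, h4, rfl, rfl, h5⟩
    simp_rw [h2, ← Finset.mul_sum]
    rw [hP, ← h.sum_halfLaw h1 hwp (I.swap.part τ z), mul_right_comm,
      ← h.sum_deficit_halfLaw h1 hwp]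
    simp_rw [← Finset.sum_mul, ← Finset.mul_sum]
  · have h2 : ∀ v s t, deficit (fun u => prob (runLaw φ H₀ H₁ bob) fun ω =>
        ω.noisySecret = u ∧ (ω.otherSecret, ω.bobView) = (v, z, I, σ, τ, s, t)) =
        K * (halfLaw φ H₀ H₁ (I.part σ z) s v *
          deficit (halfLaw φ H₀ H₁ (I.swap.part τ z) t)) := by
      intro v s t
      rw [← mul_assoc, ← deficit_const_mul]
      refine congrArg deficit (funext fun u => ?_)
      rw [mul_assoc, hK, ← prob_view]
      refine prob_congr _ fun ω => ?_
      simp only [Run.noisySecret, Run.otherSecret, Run.bobView, Prod.mk.injEq]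
      constructor
      · rintro ⟨h3, h4, rfl, rfl, h5⟩
        rw [if_neg hc] at h3 h4
        exact ⟨h4, h3, rfl, rfl, h5⟩
      · rintro ⟨h3, h4, rfl, rfl, h5⟩
        rw [if_neg hc, if_neg hc]
        exact ⟨h4, h3, rfl, rfl, h5⟩
    simp_rw [h2, ← Finset.mul_sum]
    rw [hP, mul_assoc, ← h.sum_deficit_halfLaw h1 hwp, ← h.sum_halfLaw h1 hwp (I.part σ z)]
    simp_rw [← Finset.sum_mul]

/-- Secrecy for a fixed matrix `H₁` that hashes well on average over the permutations of all
erasure patterns with at least `e₀` erasures. -/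
lemma IsParityCheck.condEntropy_ge (h0 : 0 ≤ φ) (h1 : φ < 1 / 2) (h : IsParityCheck C H₀)
    (hwp : WellPosed H₀ H₁) (bob : BobStrategy n) {θ e₀ : ℝ} (hθ : 0 ≤ θ)
    (hB : ∀ E : Fin n → Bool, e₀ ≤ ((Finset.univ.filter fun j => E j = true).card : ℝ) →
      ∑ σ : Equiv.Perm (Fin n), 1 / (n.factorial : ℝ) *
        hashDeficit C (flipProb φ) H₁ (fun j => E (σ j)) ≤ θ) :
    m - (θ + m * ∑ z : Received n,
        if ((Finset.univ.filter fun i => isErased (z i) = true).card : ℝ) < 2 * e₀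
          then ∏ i, pairMass φ (z i) else 0) ≤
      condEntropy (runLaw φ H₀ H₁ bob) Run.noisySecret (fun ω => (ω.otherSecret, ω.bobView)) := by
  rw [condEntropy_eq (runLaw_nonneg h0 h1 H₀ H₁ bob), h.sum_runLaw h1 hwp, logb_card_bits, mul_one,
    sub_le_sub_iff_left, sum_view]
  simp_rw [h.sum_deficit_view h1 hwp]
  set D := hashDeficit C (flipProb φ) H₁ with hD
  set few : Received n → Prop := fun z =>
    ((Finset.univ.filter fun i => isErased (z i) = true).card : ℝ) < 2 * e₀ with hfew
  set P : Received n → ℝ := fun z => ∏ i, pairMass φ (z i) with hPdef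
  have hP0 : ∀ z, 0 ≤ P z := fun z => Finset.prod_nonneg fun i _ => pairMass_nonneg h0 h1 _
  -- With few erasures in all, the trivial bound `m` is used. Otherwise the noisier half holds at
  -- least half of `2 * e₀` erasures, and `hB` applies to its pattern in increasing order (`σ = 1`).
  have hG : ∀ (z : Received n) (I : Halving n), I.swap.erasures z ≤ I.erasures z →
      ∑ σ, 1 / (n.factorial : ℝ) * D (fun j => isErased (I.part σ z j)) ≤
        θ + if few z then (m : ℝ) else 0 := by
    intro z I hI
    split_ifs with hf
    · have : ∑ σ, 1 / (n.factorial : ℝ) * D (fun j => isErased (I.part σ z j)) ≤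
          ∑ σ : Equiv.Perm (Fin n), 1 / (n.factorial : ℝ) * (m : ℝ) :=
        Finset.sum_le_sum fun σ _ => mul_le_mul_of_nonneg_left
          (hashDeficit_le H₁ (noiseLaw_nonneg h1) _) (by positivity)
      rw [sum_perm] at this
      linarith
    · rw [add_zero]
      refine hB (fun j => isErased (I.part 1 z j)) ?_
      rw [← I.erasures_eq 1 z]
      have h2 := I.erasures_add z
      have h3 : ((Finset.univ.filter fun i => isErased (z i) = true).card : ℝ) ≤
          2 * (I.erasures z : ℝ) := by
        rw [← h2]; push_cast
        have : (I.swap.erasures z : ℝ) ≤ I.erasures z := by exact_mod_cast hI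
        linarith
      simp only [hfew, not_lt] at hf
      linarith
  have hzI : ∀ (z : Received n) (I : Halving n), ∑ σ, ∑ τ,
      (bob z I).toReal * (1 / (n.factorial : ℝ)) * (1 / (n.factorial : ℝ)) *
        (P z * if I.swap.erasures z ≤ I.erasures z then D (fun j => isErased (I.part σ z j)) else
          D (fun j => isErased (I.swap.part τ z j))) ≤
      (bob z I).toReal * (P z * (θ + if few z then (m : ℝ) else 0)) := by
    intro z I
    have hb : 0 ≤ (bob z I).toReal * P z := mul_nonneg ENNReal.toReal_nonneg (hP0 z)
    rw [← mul_assoc]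
    by_cases hc : I.swap.erasures z ≤ I.erasures z
    · simp only [if_pos hc]
      refine le_trans (le_of_eq ?_) (mul_le_mul_of_nonneg_left (hG z I hc) hb)
      rw [Finset.mul_sum]
      refine Finset.sum_congr rfl fun σ _ => ?_
      rw [← sum_perm (n := n) ((bob z I).toReal * P z * _)]
      exact Finset.sum_congr rfl fun τ _ => by ring
    · have hc' : I.swap.swap.erasures z ≤ I.swap.erasures z := by
        rw [I.swap_swap]; exact (not_le.1 hc).le
      simp only [if_neg hc]
      refine le_trans (le_of_eq ?_) (mul_le_mul_of_nonneg_left (hG z I.swap hc') hb)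
      rw [Finset.mul_sum, Finset.sum_comm]
      refine Finset.sum_congr rfl fun σ _ => ?_
      rw [← sum_perm (n := n) ((bob z I).toReal * P z * _)]
      exact Finset.sum_congr rfl fun τ _ => by ring
  calc _ ≤ ∑ z, ∑ I, (bob z I).toReal * (P z * (θ + if few z then (m : ℝ) else 0)) :=
        Finset.sum_le_sum fun z _ => Finset.sum_le_sum fun I _ => hzI z I
    _ = ∑ z, P z * (θ + if few z then (m : ℝ) else 0) :=
        Finset.sum_congr rfl fun z _ => by rw [← Finset.sum_mul, sum_bob, one_mul]
    _ = θ + m * ∑ z, if few z then P z else 0 := by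
        simp_rw [mul_add]
        rw [Finset.sum_add_distrib, ← Finset.sum_mul, Finset.mul_sum]
        congr 1
        · rw [hPdef, sum_pi_prod fun _ => pairMass φ]
          simp [sum_pairMass]
        · exact Finset.sum_congr rfl fun z _ => by split_ifs <;> ring

end Secrecy

/-! ### Random matrices -/

lemma one_div_log_two_le : 1 / Real.log 2 ≤ 2 := by
  have := Real.log_two_gt_d9
  rw [div_le_iff₀ (by linarith)]
  linarith

section Random

variable {n m : ℕ} {C : Submodule (ZMod 2) (Bits n)} [Fintype C] {p : ℝ}

/-- The number of wrong bits in the noise vector `e`, outside of the erasure pattern `E`. -/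
def noiseWeight (E : Fin n → Bool) (e : Bits n) : ℕ :=
  (Finset.univ.filter fun j => E j = false ∧ e j = 1).card

/-- The number of accepted bits of an erasure pattern. -/
def accepted (E : Fin n → Bool) : ℕ := (Finset.univ.filter fun j => E j = false).card

lemma card_erased_add_accepted (E : Fin n → Bool) :
    (Finset.univ.filter fun j => E j = true).card + accepted E = n := by
  have := Finset.card_filter_add_card_filter_not (s := (Finset.univ : Finset (Fin n)))
    (fun j => E j = true)
  simpa [accepted] using this

/-- Each wrong accepted bit replaces a factor `1 - p` by `p < 1 - p`, so the mass is largest at the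
least weight allowed, `a p - D` with `a` accepted bits; `D` costs `log (1 - p) - log p` per unit. -/
lemma prod_noiseLaw_le (hp0 : 0 < p) (hp1 : p < 1 / 2) (E : Fin n → Bool) (e : Bits n) {D : ℝ}
    (hD : accepted E * p - D ≤ noiseWeight E e) :
    ∏ j, noiseLaw p (E j) (e j) ≤
      Real.exp (-((Finset.univ.filter fun j => E j = true).card : ℝ) * Real.log 2 -
        accepted E * Real.binEntropy p + D * (Real.log (1 - p) - Real.log p)) := by
  have hL : 0 ≤ Real.log (1 - p) - Real.log p :=
    sub_nonneg.2 (Real.log_le_log hp0 (by linarith))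
  have h1 : ∀ j, noiseLaw p (E j) (e j) = Real.exp (
      (if E j = true then 1 else 0) * -Real.log 2 + (if E j = false then 1 else 0) * Real.log (1 - p)
      - (if E j = false ∧ e j = 1 then 1 else 0) * (Real.log (1 - p) - Real.log p)) := by
    intro j
    generalize e j = x
    revert x
    refine forall_zmod_two ?_ ?_ <;> cases E j <;>
      simp [noiseLaw, bsc, Real.exp_log hp0, Real.exp_log (show 0 < 1 - p by linarith), Real.exp_neg,
        Real.exp_log (show (0 : ℝ) < 2 by norm_num)]
  simp_rw [h1]
  rw [← Real.exp_sum, Real.exp_le_exp, Finset.sum_sub_distrib, Finset.sum_add_distrib,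
    ← Finset.sum_mul, ← Finset.sum_mul, ← Finset.sum_mul, Finset.sum_boole, Finset.sum_boole,
    Finset.sum_boole]
  change _ + (accepted E : ℝ) * _ - (noiseWeight E e : ℝ) * _ ≤ _
  have := mul_le_mul_of_nonneg_right hD hL
  rw [Real.binEntropy_eq_negMulLog_add_negMulLog_one_sub, Real.negMulLog, Real.negMulLog]
  linarith

/-- Erased positions never count and each accepted bit is wrong with probability `p`: the weight is
a sum of independent indicators with mean `accepted E * p`. -/
lemma sum_atypical_le (hp : ∀ b e, 0 ≤ noiseLaw p b e) (hn : 0 < n) (E : Fin n → Bool) {D : ℝ}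
    (hD : 0 ≤ D) :
    (∑ e : Bits n, if (noiseWeight E e : ℝ) < accepted E * p - D
      then ∏ j, noiseLaw p (E j) (e j) else 0) ≤ Real.exp (-(D ^ 2 / (2 * n))) := by
  refine chernoff_lower (w := fun j => noiseLaw p (E j)) (fun j a => hp _ _)
    (fun j => sum_noiseLaw p _) (fun j a => E j = false ∧ a = 1) (le_of_eq ?_) hD
    (by exact_mod_cast hn) (by simp)
  have : ∀ j, (∑ a : ZMod 2, if E j = false ∧ a = 1 then noiseLaw p (E j) a else 0) =
      (if E j = false then 1 else 0) * p := by
    intro j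
    rw [sum_zmod_two]
    cases E j <;> simp [noiseLaw, bsc]
  simp_rw [this]
  rw [← Finset.sum_mul, Finset.sum_boole]
  rfl

/-- The noise `s + c` is independent of the codeword, so the mass of an event on the noise does not
involve the code. -/
lemma sum_code_shift (E : Fin n → Bool) (F : Bits n → ℝ) :
    ∑ s, ∑ c : C, (if F (s + c) < 0 then codeMass C p E s c else 0) =
      ∑ s : Bits n, if F s < 0 then ∏ j, noiseLaw p (E j) (s j) else 0 := by
  rw [Finset.sum_comm]
  have : ∀ c : C, ∑ s : Bits n, (if F (s + c) < 0 then codeMass C p E s c else 0) =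
      1 / (Nat.card C : ℝ) * ∑ s : Bits n, if F s < 0 then ∏ j, noiseLaw p (E j) (s j) else 0 := by
    intro c
    rw [← sum_noise_shift (c : Bits n) fun s => if F s < 0 then ∏ j, noiseLaw p (E j) (s j) else 0,
      Finset.mul_sum]
    refine Finset.sum_congr rfl fun s _ => ?_
    unfold codeMass
    rw [mul_ite, mul_zero]
    rfl
  simp_rw [this]
  rw [Finset.sum_const, Finset.card_univ, nsmul_eq_mul, ← Nat.card_eq_fintype_card, ← mul_assoc,
    mul_one_div_cancel (by exact_mod_cast Nat.card_pos.ne'), one_mul]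

lemma card_code : (Nat.card C : ℝ) = 2 ^ Module.finrank (ZMod 2) C := by
  rw [Nat.card_eq_fintype_card, Module.card_eq_pow_finrank (K := ZMod 2), ZMod.card]
  push_cast; rfl

/-- The average over the matrices `H₁` of the deficit of the hash value. -/
lemma sum_hashDeficit_le (hp0 : 0 < p) (hp1 : p < 1 / 2) (hp : ∀ b e, 0 ≤ noiseLaw p b e)
    (hn : 0 < n) (E : Fin n → Bool) {D : ℝ} (hD : 0 ≤ D) :
    ∑ H₁ : Matrix (Fin m) (Fin n) (ZMod 2), hashDeficit C p H₁ E ≤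
      Fintype.card (Matrix (Fin m) (Fin n) (ZMod 2)) *
        (2 * Real.exp (((m : ℝ) - Module.finrank (ZMod 2) C) * Real.log 2 +
          accepted E * (Real.log 2 - Real.binEntropy p) + D * (Real.log (1 - p) - Real.log p)) +
        m * Real.exp (-(D ^ 2 / (2 * n)))) := by
  classical
  set X := Real.exp (-((Finset.univ.filter fun j => E j = true).card : ℝ) * Real.log 2 -
        accepted E * Real.binEntropy p + D * (Real.log (1 - p) - Real.log p)) with hX
  have hu : Universal fun (H : Matrix (Fin m) (Fin n) (ZMod 2)) (c : C) => H.mulVec (c : Bits n) :=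
    (universal_mulVec n m).comp_injective Subtype.val_injective
  -- `F` is negative exactly on the noise vectors with too few wrong bits, which may be too likely
  -- individually. They form the part `g`, charged `m` bits per unit of mass.
  let F : Bits n → ℝ := fun e => (noiseWeight E e : ℝ) - (accepted E * p - D)
  have key := hu.sum_deficit_le (β := Bits n)
    (f := fun s c => if F (s + c) < 0 then 0 else codeMass C p E s c)
    (g := fun s c => if F (s + c) < 0 then codeMass C p E s c else 0)
    (fun s c => by split_ifs; exacts [le_rfl, codeMass_nonneg hp E s c])
    (fun s c => by split_ifs; exacts [codeMass_nonneg hp E s c, le_rfl])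
    (q := 1 / (Nat.card C : ℝ) * X) (by positivity)
    (fun s c => by
      split_ifs with h
      · positivity
      · refine mul_le_mul_of_nonneg_left ?_ (by positivity)
        exact prod_noiseLaw_le hp0 hp1 E (s + c) (by simpa [F] using h))
  have h1 : ∀ s (c : C), (if F (s + c) < 0 then 0 else codeMass C p E s c) +
      (if F (s + c) < 0 then codeMass C p E s c else 0) = codeMass C p E s c := by
    intro s c; split_ifs <;> simp
  simp only [h1] at key
  rw [sum_code_shift E F, logb_card_bits] at key
  refine key.trans (mul_le_mul_of_nonneg_left (add_le_add ?_ ?_) (Nat.cast_nonneg _))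
  -- Of the `n` bits from the number of outputs, the erased positions in `X` cancel their share; one
  -- bit per accepted position remains, whence `log 2 - binEntropy p`.
  · have h2 : (Fintype.card (Bits n) : ℝ) * (Fintype.card (Bits m) * (1 / (Nat.card C : ℝ) * X)) =
        Real.exp (((m : ℝ) - Module.finrank (ZMod 2) C) * Real.log 2 +
          accepted E * (Real.log 2 - Real.binEntropy p) + D * (Real.log (1 - p) - Real.log p)) := by
      have h3 : ∀ k : ℕ, (2 : ℝ) ^ k = Real.exp (k * Real.log 2) := fun k => by
        rw [mul_comm, ← Real.rpow_def_of_pos (by norm_num), Real.rpow_natCast]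
      rw [card_bits, card_bits, card_code, one_div]
      push_cast
      rw [h3, h3, h3, ← Real.exp_neg, hX, ← Real.exp_add, ← Real.exp_add, ← Real.exp_add]
      congr 1
      have := card_erased_add_accepted E
      have : (n : ℝ) = ((Finset.univ.filter fun j => E j = true).card : ℝ) + accepted E := by
        exact_mod_cast this.symm
      rw [this]
      ring
    rw [h2, div_eq_mul_one_div, mul_comm]
    exact mul_le_mul_of_nonneg_right one_div_log_two_le (Real.exp_pos _).le
  · refine mul_le_mul_of_nonneg_left ?_ (Nat.cast_nonneg _)
    have := sum_atypical_le hp hn E hD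
    simpa only [F, sub_neg] using this

/-- The average of the deficit over the permutations of an erasure pattern. -/
noncomputable def avgDeficit (C : Submodule (ZMod 2) (Bits n)) [Fintype C] (p : ℝ)
    (H₁ : Matrix (Fin m) (Fin n) (ZMod 2)) (E : Fin n → Bool) : ℝ :=
  ∑ σ : Equiv.Perm (Fin n), 1 / (n.factorial : ℝ) * hashDeficit C p H₁ (fun j => E (σ j))

lemma card_filter_perm (E : Fin n → Bool) (σ : Equiv.Perm (Fin n)) :
    (Finset.univ.filter fun j => E (σ j) = true).card =
      (Finset.univ.filter fun j => E j = true).card := by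
  refine Finset.card_bij (fun j _ => σ j) ?_ (fun a _ b _ h => σ.injective h) ?_
  · intro j hj
    simpa using hj
  · intro j hj
    exact ⟨σ.symm j, by simpa using hj, by simp⟩

lemma exists_perm_of_card_eq {E E' : Fin n → Bool}
    (h : (Finset.univ.filter fun j => E j = true).card =
      (Finset.univ.filter fun j => E' j = true).card) :
    ∃ π : Equiv.Perm (Fin n), ∀ j, E j = E' (π j) := by
  classical
  have h1 : Fintype.card {j // E j = true} = Fintype.card {j // E' j = true} := by
    rw [Fintype.card_subtype, Fintype.card_subtype, h]
  let e := Fintype.equivOfCardEq h1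
  refine ⟨e.extendSubtype, fun j => ?_⟩
  by_cases hj : E j = true
  · rw [hj, e.extendSubtype_mem j hj]
  · have := e.extendSubtype_not_mem j hj
    simp only [Bool.not_eq_true] at hj this
    rw [hj, this]

/-- Two such patterns differ by a permutation, which the average over `σ` absorbs. The `2^n`
patterns thus reduce to `n + 1` classes. -/
lemma avgDeficit_congr (H₁ : Matrix (Fin m) (Fin n) (ZMod 2)) {E E' : Fin n → Bool}
    (h : (Finset.univ.filter fun j => E j = true).card =
      (Finset.univ.filter fun j => E' j = true).card) :
    avgDeficit C p H₁ E = avgDeficit C p H₁ E' := by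
  obtain ⟨π, hπ⟩ := exists_perm_of_card_eq h
  unfold avgDeficit
  refine Fintype.sum_equiv (Equiv.mulLeft π) _ _ fun σ => ?_
  simp [hπ]

lemma avgDeficit_nonneg (hp : ∀ b e, 0 ≤ noiseLaw p b e) (H₁ : Matrix (Fin m) (Fin n) (ZMod 2))
    (E : Fin n → Bool) : 0 ≤ avgDeficit C p H₁ E :=
  Finset.sum_nonneg fun σ _ => mul_nonneg (by positivity) (hashDeficit_nonneg H₁ hp _)

lemma markov_card {X : Type} [Fintype X] {f : X → ℝ} (hf : ∀ x, 0 ≤ f x) {θ : ℝ} (hθ : 0 < θ)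
    {P : X → Prop} [DecidablePred P] (hP : ∀ x, P x → θ ≤ f x) {B : ℝ} (hB : ∑ x, f x ≤ B) :
    ((Finset.univ.filter P).card : ℝ) ≤ B / θ := by
  rw [le_div_iff₀ hθ]
  refine le_trans ?_ hB
  rw [← nsmul_eq_mul, ← Finset.sum_const]
  refine (Finset.sum_le_sum fun x hx => hP x (Finset.mem_filter.1 hx).2).trans ?_
  exact Finset.sum_le_univ_sum_of_nonneg hf

open Classical in
/-- Most matrices hash well on average over the permutations of each erasure pattern. -/
lemma card_bad_hash_le (hp : ∀ b e, 0 ≤ noiseLaw p b e) {e₀ γ θ : ℝ} (hθ : 0 < θ) (hγ : 0 ≤ γ)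
    (h : ∀ E : Fin n → Bool, e₀ ≤ ((Finset.univ.filter fun j => E j = true).card : ℝ) →
      ∑ H₁ : Matrix (Fin m) (Fin n) (ZMod 2), hashDeficit C p H₁ E ≤
        Fintype.card (Matrix (Fin m) (Fin n) (ZMod 2)) * γ) :
    ((Finset.univ.filter fun H₁ : Matrix (Fin m) (Fin n) (ZMod 2) => ∃ E : Fin n → Bool,
        e₀ ≤ ((Finset.univ.filter fun j => E j = true).card : ℝ) ∧
          θ < avgDeficit C p H₁ E).card : ℝ) ≤
      (n + 1) * (Fintype.card (Matrix (Fin m) (Fin n) (ZMod 2)) * γ / θ) := by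
  -- One event for each number of erasures: a single representative pattern decides it, Markov's
  -- inequality bounds it, and the union bound costs only `n + 1`.
  let bad : ℕ → Finset (Matrix (Fin m) (Fin n) (ZMod 2)) := fun e =>
    Finset.univ.filter fun H₁ => ∃ E : Fin n → Bool,
      (Finset.univ.filter fun j => E j = true).card = e ∧ e₀ ≤ (e : ℝ) ∧ θ < avgDeficit C p H₁ E
  have hsub : (Finset.univ.filter fun H₁ : Matrix (Fin m) (Fin n) (ZMod 2) =>
      ∃ E : Fin n → Bool, e₀ ≤ ((Finset.univ.filter fun j => E j = true).card : ℝ) ∧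
        θ < avgDeficit C p H₁ E) ⊆ (Finset.range (n + 1)).biUnion bad := by
    intro H₁ hH
    obtain ⟨E, h1, h2⟩ := (Finset.mem_filter.1 hH).2
    refine Finset.mem_biUnion.2 ⟨_, Finset.mem_range.2 ?_,
      Finset.mem_filter.2 ⟨Finset.mem_univ _, E, rfl, h1, h2⟩⟩
    have := card_erased_add_accepted E
    omega
  have hbad : ∀ e, ((bad e).card : ℝ) ≤
      Fintype.card (Matrix (Fin m) (Fin n) (ZMod 2)) * γ / θ := by
    intro e
    rcases (bad e).eq_empty_or_nonempty with h0 | ⟨H, hH⟩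
    · rw [h0, Finset.card_empty, Nat.cast_zero]; positivity
    obtain ⟨E, hE, he, -⟩ := (Finset.mem_filter.1 hH).2
    refine markov_card (f := fun H₁ => avgDeficit C p H₁ E) (fun H₁ => avgDeficit_nonneg hp H₁ E) hθ
      ?_ ?_
    · rintro H₁ ⟨E', hE', -, h2⟩
      rw [avgDeficit_congr H₁ (hE.trans hE'.symm)]
      exact h2.le
    · unfold avgDeficit
      rw [Finset.sum_comm]
      refine le_of_le_of_eq (Finset.sum_le_sum fun σ _ => ?_) (sum_perm (n := n) _)
      rw [← Finset.mul_sum]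
      refine mul_le_mul_of_nonneg_left (h _ ?_) (by positivity)
      rw [card_filter_perm, hE]
      exact he
  calc _ ≤ (((Finset.range (n + 1)).biUnion bad).card : ℝ) := by
        exact_mod_cast Finset.card_le_card hsub
    _ ≤ ∑ e ∈ Finset.range (n + 1), ((bad e).card : ℝ) := by exact_mod_cast Finset.card_biUnion_le
    _ ≤ _ := by
        refine (Finset.sum_le_sum fun e _ => hbad e).trans (le_of_eq ?_)
        rw [Finset.sum_const, Finset.card_range, nsmul_eq_mul]
        push_cast; rfl

open Classical in
/-- Most matrices allow all secrets to be encoded. -/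
lemma card_not_surjective_le :
    ((Finset.univ.filter fun H₁ : Matrix (Fin m) (Fin n) (ZMod 2) =>
        ¬ ∀ u : Bits m, ∃ c : C, H₁.mulVec (c : Bits n) = u).card : ℝ) ≤
      Fintype.card (Matrix (Fin m) (Fin n) (ZMod 2)) *
        Real.exp (((m : ℝ) - Module.finrank (ZMod 2) C) * Real.log 2) := by
  have hu : Universal fun (H : Matrix (Fin m) (Fin n) (ZMod 2)) (c : C) => H.mulVec (c : Bits n) :=
    (universal_mulVec n m).comp_injective Subtype.val_injective
  have hC : (0 : ℝ) < Fintype.card C := by exact_mod_cast Fintype.card_pos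
  -- The leftover hash lemma for a uniform codeword with no observation. If `H₁` is not onto, the
  -- image is a subgroup with at most half of all strings, and Cauchy–Schwarz on it makes the
  -- `χ²`-distance at least 1; Markov's inequality then counts these matrices.
  have key := hu.sum_chiSq_le (f := fun _ : C => 1 / (Fintype.card C : ℝ)) (fun _ => by positivity)
    (q := 1 / (Fintype.card C : ℝ)) (by positivity) fun _ => le_rfl
  simp only [sum_pushMass] at key
  rw [Finset.sum_const, Finset.card_univ, nsmul_eq_mul,
    mul_one_div_cancel hC.ne'] at key
  simp only [div_one] at key
  have hone : ∀ H₁ : Matrix (Fin m) (Fin n) (ZMod 2),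
      ∑ u, pushMass (fun c : C => H₁.mulVec (c : Bits n)) (fun _ => 1 / (Fintype.card C : ℝ)) u = 1 := by
    intro H₁
    rw [sum_pushMass, Finset.sum_const, Finset.card_univ, nsmul_eq_mul,
      mul_one_div_cancel hC.ne']
  have hval : (Fintype.card (Bits m) : ℝ) * (1 / (Fintype.card C : ℝ)) =
      Real.exp (((m : ℝ) - Module.finrank (ZMod 2) C) * Real.log 2) := by
    have h3 : ∀ k : ℕ, (2 : ℝ) ^ k = Real.exp (k * Real.log 2) := fun k => by
      rw [mul_comm, ← Real.rpow_def_of_pos (by norm_num), Real.rpow_natCast]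
    rw [card_bits, ← Nat.card_eq_fintype_card, card_code, one_div]
    push_cast
    rw [h3, h3, ← Real.exp_neg, ← Real.exp_add]
    congr 1
    ring
  rw [hval] at key
  have := markov_card (θ := 1) (fun H₁ => ?_) one_pos (P := fun H₁ : Matrix (Fin m) (Fin n) (ZMod 2)
    => ¬ ∀ u : Bits m, ∃ c : C, H₁.mulVec (c : Bits n) = u) ?_ key
  · rwa [div_one] at this
  · have h1 := sq_sum_le_card_mul_sum_sq (s := Finset.univ)
      (f := pushMass (fun c : C => H₁.mulVec (c : Bits n)) (fun _ => 1 / (Fintype.card C : ℝ)))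
    rw [hone, Finset.card_univ] at h1
    linarith
  · intro H₁ hH
    let S : AddSubgroup (Bits m) := (AddMonoidHom.range
      ((H₁.mulVecLin.toAddMonoidHom).comp C.subtype.toAddMonoidHom))
    have hS : ∀ u, u ∈ S ↔ ∃ c : C, H₁.mulVec (c : Bits n) = u := fun u => Iff.rfl
    have hidx : 2 ≤ S.index := by
      have h1 : S.index ≠ 1 := fun h => hH fun u => (hS u).1 (by
        rw [AddSubgroup.index_eq_one.1 h]; trivial)
      have h2 : S.index ≠ 0 := AddSubgroup.index_ne_zero_of_finite
      omega
    have hcard := S.card_mul_index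
    have h1 := sq_sum_le_card_mul_sum_sq (s := Finset.univ.filter fun u => u ∈ S)
      (f := pushMass (fun c : C => H₁.mulVec (c : Bits n)) (fun _ => 1 / (Fintype.card C : ℝ)))
    have h2 : ∀ u, u ∉ S →
        pushMass (fun c : C => H₁.mulVec (c : Bits n)) (fun _ => 1 / (Fintype.card C : ℝ)) u = 0 := by
      intro u hu
      refine Finset.sum_eq_zero fun c _ => if_neg fun h => hu ((hS u).2 ⟨c, h⟩)
    rw [Finset.sum_filter_of_ne fun u _ h => by by_contra h3; exact h (h2 u h3), hone] at h1
    have h4 : ∑ u ∈ Finset.univ.filter (fun u => u ∈ S),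
        pushMass (fun c : C => H₁.mulVec (c : Bits n)) (fun _ => 1 / (Fintype.card C : ℝ)) u ^ 2 =
        ∑ u, pushMass (fun c : C => H₁.mulVec (c : Bits n)) (fun _ => 1 / (Fintype.card C : ℝ)) u ^ 2 :=
      Finset.sum_filter_of_ne fun u _ h => by
        by_contra h3; exact h (by rw [h2 u h3]; norm_num)
    rw [h4] at h1
    have h5 : (Finset.univ.filter fun u => u ∈ S).card = Nat.card S := by
      rw [Nat.card_eq_fintype_card, Fintype.card_subtype]
    rw [h5] at h1
    have h6 : (Nat.card S : ℝ) * 2 ≤ Fintype.card (Bits m) := by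
      rw [← Nat.card_eq_fintype_card, ← hcard]
      push_cast
      exact mul_le_mul_of_nonneg_left (by exact_mod_cast hidx) (Nat.cast_nonneg _)
    set Q := ∑ u, pushMass (fun c : C => H₁.mulVec (c : Bits n))
      (fun _ => 1 / (Fintype.card C : ℝ)) u ^ 2 with hQ
    have hQ0 : 0 ≤ Q := Finset.sum_nonneg fun u _ => sq_nonneg _
    have := mul_le_mul_of_nonneg_right h6 hQ0
    rw [one_pow] at h1
    linarith

end Random

/-! ### Secrecy -/

lemma binEnt_nonneg {p : ℝ} (h0 : 0 ≤ p) (h1 : p ≤ 1) : 0 ≤ binEnt p :=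
  div_nonneg (Real.binEntropy_nonneg h0 h1) (Real.log_nonneg one_le_two)

lemma binEnt_le_one (p : ℝ) : binEnt p ≤ 1 :=
  div_le_one_of_le₀ Real.binEntropy_le_log_two (Real.log_nonneg one_le_two)

lemma binEnt_lt_one {p : ℝ} (h : p < 1 / 2) : binEnt p < 1 := by
  unfold binEnt
  rw [div_lt_one (Real.log_pos one_lt_two), Real.binEntropy_lt_log_two]
  norm_num at h ⊢
  exact h.ne

lemma log_two_mul_one_sub_binEnt (p : ℝ) :
    Real.log 2 * (1 - binEnt p) = Real.log 2 - Real.binEntropy p := by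
  have := (Real.log_pos one_lt_two).ne'
  unfold binEnt
  field_simp

lemma sum_few_erasures_le {φ : ℝ} (h0 : 0 ≤ φ) (h1 : φ < 1 / 2) {n : ℕ} (hn : 0 < n) {η : ℝ}
    (hη : 0 ≤ η) :
    (∑ z : Received n, if ((Finset.univ.filter fun i => isErased (z i) = true).card : ℝ) <
        2 * (n * (erasureProb φ - η)) then ∏ i, pairMass φ (z i) else 0) ≤
      Real.exp (-(η ^ 2 * n)) := by
  have hn' : (0 : ℝ) < n := by exact_mod_cast hn
  have hq : ∑ w : ZMod 2 × ZMod 2, (if isErased w = true then pairMass φ w else 0) =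
      erasureProb φ := by
    rw [Fintype.sum_prod_type, sum_zmod_two, sum_zmod_two, sum_zmod_two]
    simp [isErased, pairMass]
  have := chernoff_lower (ι := Fin (2 * n)) (w := fun _ => pairMass φ)
    (fun _ w => pairMass_nonneg h0 h1 w) (fun _ => sum_pairMass φ) (fun _ w => isErased w = true)
    (q := 2 * n * erasureProb φ) (D := 2 * n * η) (N := 2 * n)
    (le_of_eq (by simp [hq])) (by positivity) (by positivity) (by simp)
  have h2 : 2 * (n * (erasureProb φ - η)) = 2 * n * erasureProb φ - 2 * n * η := by ring
  have h3 : (2 * n * η) ^ 2 / (2 * (2 * (n : ℝ))) = η ^ 2 * n := by field_simp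
  rw [h3] at this
  rw [h2]
  exact this

/-! ### Secrecy at finite length -/

section Finite

variable {φ : ℝ} {n m : ℕ} {C : Submodule (ZMod 2) (Bits n)}
  {H₀ : Matrix (Fin (n - Module.finrank (ZMod 2) C)) (Fin n) (ZMod 2)}

/-- The condition of secrecy, for a single instance of the protocol. -/
def SecretUpTo {a n : ℕ} (φ : ℝ) (H₀ : Matrix (Fin a) (Fin n) (ZMod 2)) (m : ℕ) (δ : ℝ) : Prop :=
  (1 - δ) * (Nat.card (Matrix (Fin m) (Fin n) (ZMod 2)) : ℝ) ≤
      (Nat.card {H₁ : Matrix (Fin m) (Fin n) (ZMod 2) //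
        WellPosed H₀ H₁ ∧ ∀ bob : BobStrategy n,
          (m : ℝ) - δ ≤ condEntropy (runLaw φ H₀ H₁ bob) Run.noisySecret
            (fun ω => (ω.otherSecret, ω.bobView))} : ℝ)

/-- Outside two exceptional sets, the matrices that cannot encode every secret and those that hash
some class of patterns badly, a matrix resists every strategy. `hδ₁` bounds the exceptional
fraction, `hδ₂` the loss of entropy. -/
lemma IsParityCheck.secretUpTo (h0 : 0 ≤ φ) (h1 : φ < 1 / 2) (h : IsParityCheck C H₀) [Fintype C]
    (hn : 0 < n) {η γ θ δ : ℝ} (hη : 0 ≤ η) (hγ0 : 0 ≤ γ) (hθ : 0 < θ)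
    (hγ : ∀ E : Fin n → Bool, n * (erasureProb φ - η) ≤
        ((Finset.univ.filter fun j => E j = true).card : ℝ) →
      ∑ H₁ : Matrix (Fin m) (Fin n) (ZMod 2), hashDeficit C (flipProb φ) H₁ E ≤
        Fintype.card (Matrix (Fin m) (Fin n) (ZMod 2)) * γ)
    (hδ₁ : Real.exp (((m : ℝ) - Module.finrank (ZMod 2) C) * Real.log 2) +
      (n + 1) * (γ / θ) ≤ δ)
    (hδ₂ : θ + m * Real.exp (-(η ^ 2 * n)) ≤ δ) : SecretUpTo φ H₀ m δ := by
  classical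
  have hp := noiseLaw_nonneg h1
  have hb1 := card_not_surjective_le (C := C) (m := m)
  have hb2 := card_bad_hash_le (C := C) (m := m) hp hθ hγ0 hγ
  set N := (Fintype.card (Matrix (Fin m) (Fin n) (ZMod 2)) : ℝ) with hN
  set B₁ := Finset.univ.filter fun H₁ : Matrix (Fin m) (Fin n) (ZMod 2) =>
        ¬ ∀ u : Bits m, ∃ c : C, H₁.mulVec (c : Bits n) = u with hB₁
  set B₂ := Finset.univ.filter fun H₁ : Matrix (Fin m) (Fin n) (ZMod 2) => ∃ E : Fin n → Bool,
        n * (erasureProb φ - η) ≤ ((Finset.univ.filter fun j => E j = true).card : ℝ) ∧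
          θ < avgDeficit C (flipProb φ) H₁ E with hB₂
  unfold SecretUpTo
  set G := Finset.univ.filter fun H₁ : Matrix (Fin m) (Fin n) (ZMod 2) =>
        WellPosed H₀ H₁ ∧ ∀ bob : BobStrategy n,
          (m : ℝ) - δ ≤ condEntropy (runLaw φ H₀ H₁ bob) Run.noisySecret
            (fun ω => (ω.otherSecret, ω.bobView)) with hG
  rw [Nat.card_eq_fintype_card, Nat.card_eq_fintype_card, Fintype.card_subtype, ← hN, ← hG]
  have hcover : (Finset.univ : Finset (Matrix (Fin m) (Fin n) (ZMod 2))) ⊆ G ∪ (B₁ ∪ B₂) := by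
    intro H₁ _
    by_cases h2 : H₁ ∈ B₁ ∪ B₂
    · exact Finset.mem_union_right _ h2
    refine Finset.mem_union_left _ (Finset.mem_filter.2 ⟨Finset.mem_univ _, ?_⟩)
    rw [Finset.mem_union, not_or] at h2
    obtain ⟨h3, h4⟩ := h2
    have hwp : WellPosed H₀ H₁ := by
      rw [h.wellPosed_iff]
      by_contra h5
      exact h3 (Finset.mem_filter.2 ⟨Finset.mem_univ _, h5⟩)
    refine ⟨hwp, fun bob => le_trans ?_ (h.condEntropy_ge h0 h1 hwp bob hθ.le
      (e₀ := n * (erasureProb φ - η)) fun E hE => ?_)⟩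
    · have := mul_le_mul_of_nonneg_left (sum_few_erasures_le h0 h1 hn hη) (Nat.cast_nonneg (α := ℝ) m)
      linarith
    · by_contra h5
      exact h4 (Finset.mem_filter.2 ⟨Finset.mem_univ _, E, hE, not_le.1 h5⟩)
  have hcard : N ≤ G.card + (B₁.card + B₂.card) := by
    have h2 := (Finset.card_le_card hcover).trans (Finset.card_union_le _ _)
    have h3 := Finset.card_union_le B₁ B₂
    rw [Finset.card_univ] at h2
    rw [hN]
    exact_mod_cast h2.trans (Nat.add_le_add_left h3 _)
  have hN0 : 0 ≤ N := Nat.cast_nonneg _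
  have := mul_le_mul_of_nonneg_left hδ₁ hN0
  have h6 : N * (Real.exp (((m : ℝ) - Module.finrank (ZMod 2) C) * Real.log 2) +
      (n + 1) * (γ / θ)) = N * Real.exp (((m : ℝ) - Module.finrank (ZMod 2) C) * Real.log 2) +
      (n + 1) * (N * γ / θ) := by ring
  linarith

set_option maxHeartbeats 400000 in
-- With `c = log 2 * (ε ε' / 2)` and `Λ = log (1 - p) - log p`, the hashing exponent is at most `n
-- (-2 c + η (2 log 2 + Λ))`: one `η log 2` for the rate defect of the code, one for missing
-- erasures, and `η Λ` for the typicality margin `D = η n`. By `hηε` this is at most `-c n`.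
lemma IsParityCheck.secretUpTo_exp (h0 : 0 < φ) (h1 : φ < 1 / 2) (h : IsParityCheck C H₀)
    (hn : 0 < n) {ε' η κ : ℝ} (hε' : 0 < ε') (hη : 0 ≤ η) (hκ : 0 ≤ κ)
    (hm : (m : ℝ) ≤ n * erasureProb φ * (1 - binEnt (flipProb φ) - ε'))
    (hk : n * (1 - binEnt (flipProb φ)) - η * n ≤ Module.finrank (ZMod 2) C)
    (hηε : η * (2 * Real.log 2 + (Real.log (1 - flipProb φ) - Real.log (flipProb φ))) ≤
      Real.log 2 * (erasureProb φ * ε' / 2))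
    (hκ₁ : 2 * κ ≤ Real.log 2 * (erasureProb φ * ε' / 2)) (hκ₂ : 2 * κ ≤ η ^ 2 / 2) :
    SecretUpTo φ H₀ m (2 * (n + 2) ^ 2 * Real.exp (-(κ * n))) := by
  classical
  set L := Real.log 2 with hL
  have hL0 : 0 < L := Real.log_pos one_lt_two
  set p := flipProb φ with hp
  have hp1 : p < 1 / 2 := flipProb_lt_half h1
  have hε0 : 0 < erasureProb φ := by unfold erasureProb; nlinarith
  have hε1 := erasureProb_lt_half h1
  have hp0 : 0 < p := by
    rw [hp]; unfold flipProb
    have : 0 < 1 - erasureProb φ := by linarith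
    positivity
  set Λ := Real.log (1 - p) - Real.log p with hΛ
  have hΛ0 : 0 ≤ Λ := sub_nonneg.2 (Real.log_le_log hp0 (by linarith))
  set x := 1 - binEnt p with hx
  have hx0 : 0 ≤ x := sub_nonneg.2 (binEnt_le_one p)
  have hx1 : x ≤ 1 := by have := binEnt_nonneg hp0.le (by linarith); linarith
  have hLx : L - Real.binEntropy p = L * x := (log_two_mul_one_sub_binEnt p).symm
  set ε := erasureProb φ with hε
  have hn' : (0 : ℝ) < n := by exact_mod_cast hn
  set k := (Module.finrank (ZMod 2) C : ℝ) with hkdef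
  set c := L * (ε * ε' / 2) with hc
  have hηL : η * L ≤ c := by
    have := mul_nonneg hη hΛ0
    have := mul_nonneg hη hL0.le
    linarith
  have hmn : (m : ℝ) ≤ n := by
    refine hm.trans ?_
    rw [mul_assoc]
    refine mul_le_of_le_one_right hn'.le ?_
    have := mul_le_mul_of_nonneg_left (show x - ε' ≤ 1 by linarith) hε0.le
    linarith
  have hmk : (m : ℝ) - k ≤ n * (ε * x) - n * (ε * ε') - n * x + η * n := by linarith
  have hdim : Real.exp (((m : ℝ) - k) * L) ≤ Real.exp (-(κ * n)) := by
    refine Real.exp_le_exp.2 ?_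
    have h2 : (m : ℝ) - k ≤ n * (η - ε * ε') := by
      have := mul_nonneg hn'.le (mul_nonneg (show 0 ≤ 1 - ε by linarith) hx0)
      linarith
    have h3 := mul_le_mul_of_nonneg_right h2 hL0.le
    have h4 : (η - ε * ε') * L ≤ -(2 * κ) := by rw [hc] at hηL hκ₁; linarith
    have h5 := mul_le_mul_of_nonneg_left h4 hn'.le
    have := mul_nonneg hn'.le hκ
    linarith
  set X := Real.exp (-(2 * κ * n)) with hX
  have hexp : ∀ E : Fin n → Bool, n * (ε - η) ≤
      ((Finset.univ.filter fun j => E j = true).card : ℝ) →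
      ((m : ℝ) - k) * L + accepted E * (L - Real.binEntropy p) + (η * n) * Λ ≤ -(2 * κ * n) := by
    intro E hE
    have h2 : ((Finset.univ.filter fun j => E j = true).card : ℝ) + accepted E = n := by
      exact_mod_cast card_erased_add_accepted E
    have h3 : (accepted E : ℝ) ≤ n * (1 - ε + η) := by linarith
    have h4 := mul_le_mul_of_nonneg_right h3 hx0
    have h5 : n * (η * x) ≤ n * η :=
      mul_le_mul_of_nonneg_left (mul_le_of_le_one_right hη hx1) hn'.le
    have h6 : (m : ℝ) - k + accepted E * x ≤ n * (2 * η - ε * ε') := by linarith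
    have h7 := mul_le_mul_of_nonneg_right h6 hL0.le
    have h8 : (2 * η - ε * ε') * L + η * Λ ≤ -(2 * κ) := by rw [hc] at hηε hκ₁; linarith
    have h9 := mul_le_mul_of_nonneg_left h8 hn'.le
    rw [hLx]
    linarith
  have hX2 : Real.exp (-((η * n) ^ 2 / (2 * n))) ≤ X := by
    refine Real.exp_le_exp.2 ?_
    have h2 : (η * n) ^ 2 / (2 * n) = η ^ 2 / 2 * n := by field_simp
    rw [h2]
    have := mul_le_mul_of_nonneg_right hκ₂ hn'.le
    linarith
  set Y := Real.exp (-(κ * n)) with hY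
  have hY0 : 0 < Y := Real.exp_pos _
  have hXY : X = Y * Y := by rw [hX, hY, ← Real.exp_add]; congr 1; ring
  -- The average deficit is of order `Y²`; the threshold `Y` leaves a factor `Y` both for the
  -- fraction of bad matrices and for the entropy loss.
  refine h.secretUpTo h0.le h1 hn hη (γ := (n + 2) * X) (θ := Y) (by positivity) hY0 ?_ ?_ ?_
  · intro E hE
    refine (sum_hashDeficit_le hp0 hp1 (noiseLaw_nonneg h1) hn E (D := η * n) (by positivity)).trans
      (mul_le_mul_of_nonneg_left ?_ (Nat.cast_nonneg _))
    have h2 := Real.exp_le_exp.2 (hexp E hE)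
    have h3 : (m : ℝ) * Real.exp (-((η * n) ^ 2 / (2 * n))) ≤ n * X :=
      mul_le_mul hmn hX2 (Real.exp_pos _).le hn'.le
    rw [← hX] at h2
    linarith
  · have h2 : (n + 1) * ((n + 2) * X / Y) = (n + 1) * (n + 2) * Y := by
      rw [hXY]; field_simp
    rw [h2]
    have h3 : 1 + ((n : ℝ) + 1) * (n + 2) ≤ 2 * (n + 2) ^ 2 := by nlinarith
    have h4 := mul_le_mul_of_nonneg_right h3 hY0.le
    linarith
  · have h2 : Real.exp (-(η ^ 2 * n)) ≤ Y := by
      refine Real.exp_le_exp.2 ?_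
      have := mul_le_mul_of_nonneg_right hκ₂ hn'.le
      have := mul_nonneg hκ hn'.le
      have : 0 ≤ η ^ 2 * n := by positivity
      linarith
    have h3 : (m : ℝ) * Real.exp (-(η ^ 2 * n)) ≤ n * Y :=
      mul_le_mul hmn h2 (Real.exp_pos _).le hn'.le
    have h4 : 1 + (n : ℝ) ≤ 2 * (n + 2) ^ 2 := by nlinarith
    have h5 := mul_le_mul_of_nonneg_right h4 hY0.le
    linarith

end Finite

lemma secretFromBob_of_eventually {φ : ℝ} {n a m : ℕ → ℕ}
    {H₀ : ∀ i, Matrix (Fin (a i)) (Fin (n i)) (ZMod 2)} {δ : ℕ → ℝ} (hδ : Tendsto δ atTop (𝓝 0))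
    (h : ∀ᶠ i in atTop, SecretUpTo φ (H₀ i) (m i) (δ i)) :
    SecretFromBob φ n a m H₀ := by
  classical
  -- At the remaining indices `δ = 1`, for which the counting condition is void.
  refine ⟨fun i => if SecretUpTo φ (H₀ i) (m i) (δ i)
    then δ i else 1, hδ.congr' ?_, fun i => ?_⟩
  · filter_upwards [h] with i hi
    rw [if_pos hi]
  · dsimp only
    split_ifs with hi
    · exact hi
    · rw [sub_self, zero_mul]
      positivity

lemma tendsto_poly_exp {κ : ℝ} (hκ : 0 < κ) :
    Tendsto (fun n : ℕ => 2 * ((n : ℝ) + 2) ^ 2 * Real.exp (-(κ * n))) atTop (𝓝 0) := by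
  have h : ∀ j : ℕ, Tendsto (fun n : ℕ => (n : ℝ) ^ j * Real.exp (-κ * n)) atTop (𝓝 0) := fun j => by
    have := (Real.tendsto_pow_mul_exp_neg_atTop_nhds_zero j).comp
      ((tendsto_natCast_atTop_atTop (R := ℝ)).const_mul_atTop hκ)
    have h2 := this.const_mul ((κ ^ j)⁻¹)
    rw [mul_zero] at h2
    refine h2.congr fun n => ?_
    simp only [Function.comp_apply, mul_pow]
    field_simp
  have h3 := (((h 2).const_mul 2).add ((h 1).const_mul 8)).add ((h 0).const_mul 8)
  simp only [mul_zero, add_zero] at h3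
  refine h3.congr fun n => ?_
  rw [neg_mul]
  ring

lemma condEntropy_of_subsingleton {Ω α β : Type} [Fintype Ω] [Fintype α] [Fintype β]
    [Subsingleton α] (w : Ω → ℝ) (U : Ω → α) (W : Ω → β) : condEntropy w U W = 0 := by
  unfold condEntropy
  rw [neg_eq_zero]
  refine Finset.sum_eq_zero fun b _ => Finset.sum_eq_zero fun a _ => ?_
  rw [prob_congr w (A := fun ω => U ω = a ∧ W ω = b) (B := fun ω => W ω = b) fun ω =>
    and_iff_right (Subsingleton.elim _ _)]
  rcases eq_or_ne (prob w fun ω => W ω = b) 0 with h | h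
  · rw [h, zero_mul]
  · rw [div_self h, Real.logb_one, mul_zero]

/-- Covers `φ = 0`: there are no erasures, the length bound forces `m = 0`, and the exponential
estimates, which need `p > 0`, do not apply. -/
lemma secretUpTo_zero {a n : ℕ} (φ : ℝ) (H₀ : Matrix (Fin a) (Fin n) (ZMod 2)) :
    SecretUpTo φ H₀ 0 0 := by
  unfold SecretUpTo
  rw [sub_zero, one_mul]
  refine le_of_eq (congrArg _ (Nat.card_congr (Equiv.subtypeUnivEquiv fun H₁ => ⟨fun s => ?_,
    fun bob => ?_⟩).symm))
  · refine ⟨0, ?_⟩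
    unfold Encodes
    rw [Matrix.mulVec_zero]
    funext i
    rcases i with i | i
    · rfl
    · exact i.elim0
  · rw [condEntropy_of_subsingleton]
    simp

/-- Secrecy for a capacity-achieving sequence of codes. -/
theorem secretFromBob_of_capacityAchieving {φ : ℝ} (h0 : 0 ≤ φ) (h1 : φ < 1 / 2) {n : ℕ → ℕ}
    {C : ∀ i, Submodule (ZMod 2) (Bits (n i))} {D : ∀ i, Bits (n i) → Bits (n i)}
    {H₀ : ∀ i, Matrix (Fin (n i - Module.finrank (ZMod 2) (C i))) (Fin (n i)) (ZMod 2)}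
    (hH : ∀ i, IsParityCheck (C i) (H₀ i)) (hC : CapacityAchieving (flipProb φ) n C D)
    {ε' : ℝ} (hε' : 0 < ε') {m : ℕ → ℕ}
    (hm : ∀ i, (m i : ℝ) ≤ (n i : ℝ) * erasureProb φ * (1 - binEnt (flipProb φ) - ε')) :
    SecretFromBob φ n _ m H₀ := by
  classical
  rcases h0.eq_or_lt with rfl | h0'
  · have hm0 : ∀ i, m i = 0 := fun i => by
      have := hm i
      simp only [erasureProb, mul_zero, zero_mul] at this
      exact_mod_cast le_antisymm this (Nat.cast_nonneg _)
    refine secretFromBob_of_eventually (δ := fun _ => 0) tendsto_const_nhds (.of_forall fun i => ?_)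
    rw [hm0 i]
    exact secretUpTo_zero 0 (H₀ i)
  have hL0 : 0 < Real.log 2 := Real.log_pos one_lt_two
  have hp1 : flipProb φ < 1 / 2 := flipProb_lt_half h1
  have hε0 : 0 < erasureProb φ := by unfold erasureProb; nlinarith
  have hp0 : 0 < flipProb φ := by
    unfold flipProb
    have : 0 < 1 - erasureProb φ := by linarith [erasureProb_lt_half h1]
    positivity
  have hΛ0 : 0 ≤ Real.log (1 - flipProb φ) - Real.log (flipProb φ) :=
    sub_nonneg.2 (Real.log_le_log hp0 (by linarith))
  set c := Real.log 2 * (erasureProb φ * ε' / 2) with hc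
  have hc0 : 0 < c := by positivity
  set M := 2 * Real.log 2 + (Real.log (1 - flipProb φ) - Real.log (flipProb φ)) with hM
  have hM0 : 0 < M := by positivity
  -- `η` spends exactly the budget of `secretUpTo_exp`; `κ` is then the largest exponent that its
  -- last two conditions allow.
  set η := c / M with hη
  have hη0 : 0 < η := by positivity
  set κ := min (c / 2) (η ^ 2 / 4) with hκ
  have hκ0 : 0 < κ := lt_min (by positivity) (by positivity)
  refine secretFromBob_of_eventually
    (δ := fun i => 2 * ((n i : ℝ) + 2) ^ 2 * Real.exp (-(κ * n i)))
    ((tendsto_poly_exp hκ0).comp hC.length) ?_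
  have hk := hC.rate.eventually (lt_mem_nhds (show 1 - binEnt (flipProb φ) - η <
    1 - binEnt (flipProb φ) by linarith))
  filter_upwards [hk, hC.length.eventually (eventually_gt_atTop 0)] with i hi hn
  have hn' : (0 : ℝ) < n i := by exact_mod_cast hn
  rw [lt_div_iff₀ hn'] at hi
  refine (hH i).secretUpTo_exp h0' h1 hn hε' hη0.le hκ0.le (hm i) (by linarith) ?_ ?_ ?_
  · rw [← hM, ← hc, hη, div_mul_cancel₀ _ hM0.ne']
  · have := min_le_left (c / 2) (η ^ 2 / 4); linarith
  · have := min_le_right (c / 2) (η ^ 2 / 4); linarith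

/-! ### Correctness -/

section Honest

variable {n : ℕ}

/-- Swapping the two halves. -/
def Halving.swapEquiv (n : ℕ) : Halving n ≃ Halving n :=
  ⟨Halving.swap, Halving.swap, Halving.swap_swap, Halving.swap_swap⟩

lemma honestBob_false_apply (z : Received n) (I : Halving n) :
    honestBob false z I = honestHalf z I.swap := by
  classical
  unfold honestBob
  simp only [Bool.false_eq_true, if_false, PMF.map_apply]
  rw [tsum_eq_single I.swap]
  · rw [I.swap_swap, if_pos rfl]
  · intro J hJ
    rw [if_neg]
    rintro rfl
    exact hJ J.swap_swap.symm

lemma honestBob_true_apply (z : Received n) (I : Halving n) :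
    honestBob true z I = honestHalf z I := rfl

lemma mem_goodHalves {z : Received n} {G : Halving n} :
    G ∈ goodHalves z ↔ ∀ i ∈ (G : Finset (Fin (2 * n))), (z i).1 = (z i).2 := by
  simp [goodHalves]

open Classical in
lemma sum_honestHalf_good (z : Received n) (hz : (goodHalves z).Nonempty) :
    ∑ I, (if I ∈ goodHalves z then (honestHalf z I).toReal else 0) = 1 := by
  have h := PMF.tsum_coe (honestHalf z)
  rw [tsum_fintype] at h
  have h2 := congrArg ENNReal.toReal h
  rw [ENNReal.toReal_sum fun I _ => (honestHalf z).apply_ne_top I, ENNReal.toReal_one] at h2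
  rw [← h2]
  refine Finset.sum_congr rfl fun I _ => ?_
  split_ifs with hI
  · rfl
  · unfold honestHalf
    rw [dif_pos hz, PMF.uniformOfFinset_apply_of_notMem hz hI, ENNReal.toReal_zero]

lemma goodHalves_nonempty {z : Received n}
    (h : n ≤ (Finset.univ.filter fun i => isErased (z i) = false).card) :
    (goodHalves z).Nonempty := by
  obtain ⟨I, hI, hc⟩ := Finset.exists_subset_card_eq h
  refine ⟨⟨I, hc⟩, mem_goodHalves.2 fun i hi => ?_⟩
  have := (Finset.mem_filter.1 (hI hi)).2
  simpa [isErased] using this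

/-- The mean number of accepted indices exceeds `n` by `2 n (1/2 - ε)`, which is positive because `ε
< 1/2`. -/
lemma sum_few_accepted_le {φ : ℝ} (h0 : 0 ≤ φ) (h1 : φ < 1 / 2) (hn : 0 < n) :
    (∑ z : Received n, if (Finset.univ.filter fun i => isErased (z i) = false).card < n then
      ∏ i, pairMass φ (z i) else 0) ≤ Real.exp (-((1 / 2 - erasureProb φ) ^ 2 * n)) := by
  have hn' : (0 : ℝ) < n := by exact_mod_cast hn
  have hε := erasureProb_lt_half h1
  have hq : ∑ w : ZMod 2 × ZMod 2, (if isErased w = false then pairMass φ w else 0) =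
      1 - erasureProb φ := by
    rw [Fintype.sum_prod_type, sum_zmod_two, sum_zmod_two, sum_zmod_two]
    simp [isErased, pairMass]
  have := chernoff_lower (ι := Fin (2 * n)) (w := fun _ => pairMass φ)
    (fun _ w => pairMass_nonneg h0 h1 w) (fun _ => sum_pairMass φ) (fun _ w => isErased w = false)
    (q := 2 * n * (1 - erasureProb φ)) (D := 2 * n * (1 / 2 - erasureProb φ)) (N := 2 * n)
    (le_of_eq (by simp [hq]; ring)) (mul_nonneg (by positivity) (by linarith)) (by positivity) (by simp)
  have h2 : 2 * n * (1 - erasureProb φ) - 2 * n * (1 / 2 - erasureProb φ) = n := by ring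
  have h3 : (2 * n * (1 / 2 - erasureProb φ)) ^ 2 / (2 * (2 * (n : ℝ))) =
      (1 / 2 - erasureProb φ) ^ 2 * n := by field_simp
  rw [h3, h2] at this
  simpa only [Nat.cast_lt] using this

end Honest

section Correct

variable {n m : ℕ} {φ : ℝ} {C : Submodule (ZMod 2) (Bits n)}
  {H₀ : Matrix (Fin (n - Module.finrank (ZMod 2) C)) (Fin n) (ZMod 2)}
  {H₁ : Matrix (Fin m) (Fin n) (ZMod 2)}

lemma prod_bsc_sum (p : ℝ) (c : Bits n) : ∑ s : Bits n, ∏ j, bsc p (c j) (s j) = 1 := by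
  rw [sum_pi_prod fun j => bsc p (c j)]
  refine Finset.prod_eq_one fun j _ => ?_
  rw [sum_zmod_two]
  generalize c j = x
  revert x
  refine forall_zmod_two ?_ ?_ <;> simp [bsc]

lemma one_sub_decodingError [Fintype C] (p : ℝ) (D : Bits n → Bits n) :
    1 - decodingError p C D = ∑ c : C, 1 / (Nat.card C : ℝ) * ∑ s : Bits n,
      if D s = c then ∏ j, bsc p ((c : Bits n) j) (s j) else 0 := by
  classical
  have h1 : decodingError p C D = ∑ c : C, 1 / (Nat.card C : ℝ) * ∑ s : Bits n,
      if D s ≠ c then ∏ j, bsc p ((c : Bits n) j) (s j) else 0 := by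
    unfold decodingError
    rw [Finset.mul_sum]
    congr!
  have h2 : (1 : ℝ) = ∑ c : C, 1 / (Nat.card C : ℝ) * ∑ s : Bits n,
      ∏ j, bsc p ((c : Bits n) j) (s j) := by
    simp_rw [prod_bsc_sum]
    rw [Finset.sum_const, Finset.card_univ, nsmul_eq_mul, ← Nat.card_eq_fintype_card, mul_one,
      mul_one_div_cancel (by exact_mod_cast Nat.card_pos.ne')]
  rw [h1]
  nth_rw 1 [h2]
  rw [← Finset.sum_sub_distrib]
  refine Finset.sum_congr rfl fun c _ => ?_
  rw [← mul_sub, ← Finset.sum_sub_distrib]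
  congr 1
  refine Finset.sum_congr rfl fun s _ => ?_
  by_cases h : D s = c <;> simp [h]

lemma decodingError_nonneg {p : ℝ} (h0 : 0 ≤ p) (h1 : p ≤ 1) (D : Bits n → Bits n) :
    0 ≤ decodingError p C D := by
  unfold decodingError
  refine mul_nonneg (by positivity) (Finset.sum_nonneg fun c _ => Finset.sum_nonneg fun s _ => ?_)
  split_ifs
  · exact Finset.prod_nonneg fun j _ => bsc_nonneg h0 h1 _ _
  · exact le_rfl

lemma one_sub_decodingError_nonneg {p : ℝ} (h0 : 0 ≤ p) (h1 : p ≤ 1) (D : Bits n → Bits n) :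
    0 ≤ 1 - decodingError p C D := by
  classical
  rw [one_sub_decodingError]
  refine Finset.sum_nonneg fun c _ => mul_nonneg (by positivity) (Finset.sum_nonneg fun s _ => ?_)
  split_ifs
  · exact Finset.prod_nonneg fun j _ => bsc_nonneg h0 h1 _ _
  · exact le_rfl

/-- The probability of successful decoding for a half with the received pairs `w`. -/
lemma IsParityCheck.halfSum_decoded (h1 : φ < 1 / 2) (h : IsParityCheck C H₀)
    (hwp : WellPosed H₀ H₁) (D : Bits n → Bits n) (w : Fin n → ZMod 2 × ZMod 2)
    (hw : ∀ j, isErased (w j) = false) :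
    halfSum φ H₀ H₁ w (fun u c r => if D (c + r + fun j => (w j).1) = c ∧ H₁.mulVec c = u
      then 1 else 0) = (∏ j, pairMass φ (w j)) * (1 - decodingError (flipProb φ) C D) := by
  classical
  rw [h.halfSum_eq hwp, one_sub_decodingError, Finset.mul_sum]
  refine Finset.sum_congr rfl fun c _ => ?_
  rw [mul_left_comm]
  congr 1
  -- The decoder's input is `c + r + w.1`. For fixed `c` it runs through all strings as `r` does,
  -- and its law is that of `c` after the BSC.
  rw [Finset.mul_sum, ← sum_noise_shift ((c : Bits n) + fun j => (w j).1) fun s =>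
    (∏ j, pairMass φ (w j)) * if D s = c then ∏ j, bsc (flipProb φ) ((c : Bits n) j) (s j) else 0]
  refine Finset.sum_congr rfl fun r _ => ?_
  have h2 : (c : Bits n) + r + (fun j => (w j).1) = r + ((c : Bits n) + fun j => (w j).1) := by
    rw [add_comm (c : Bits n) r, add_assoc]
  have h3 : ∀ j, pairLaw φ (r j) (w j) = pairMass φ (w j) * bsc (flipProb φ) ((c : Bits n) j)
      ((r + ((c : Bits n) + fun j => (w j).1)) j) := by
    intro j
    rw [pairLaw_eq h1, hw j]
    unfold noiseLaw
    rw [if_neg (by simp), ← bsc_add (flipProb φ) 0 _ ((c : Bits n) j), zero_add]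
    congr 2
    simp only [Pi.add_apply]
    ring
  simp_rw [h3, Finset.prod_mul_distrib, h2]
  by_cases hD : D (r + ((c : Bits n) + fun j => (w j).1)) = c <;> simp [hD]

lemma halfSum_nonneg {a : ℕ} (h0 : 0 ≤ φ) (h1 : φ < 1 / 2) (H₀ : Matrix (Fin a) (Fin n) (ZMod 2))
    (H₁ : Matrix (Fin m) (Fin n) (ZMod 2)) (w : Fin n → ZMod 2 × ZMod 2)
    {A : Bits m → Bits n → Bits n → ℝ} (hA : ∀ u c r, 0 ≤ A u c r) :
    0 ≤ halfSum φ H₀ H₁ w A :=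
  Finset.sum_nonneg fun u _ => Finset.sum_nonneg fun c _ => Finset.sum_nonneg fun r _ =>
    mul_nonneg (mul_nonneg (mul_nonneg (by positivity) (pickProb_nonneg H₀ H₁ u c))
      (Finset.prod_nonneg fun j _ => pairLaw_nonneg h0 h1 _ _)) (hA u c r)

lemma sum_perm_perm (c : ℝ) : ∑ _σ : Equiv.Perm (Fin n), ∑ _τ : Equiv.Perm (Fin n),
    1 / (n.factorial : ℝ) * (1 / (n.factorial : ℝ) * c) = c := by
  simp only [sum_perm]

/-- The probability that at least `n` of the `2 n` pairs are accepted. -/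
noncomputable def enoughProb (φ : ℝ) (n : ℕ) : ℝ :=
  open Classical in ∑ z : Received n, if (goodHalves z).Nonempty then ∏ i, pairMass φ (z i) else 0

lemma enoughProb_ge (h0 : 0 ≤ φ) (h1 : φ < 1 / 2) (hn : 0 < n) :
    1 - Real.exp (-((1 / 2 - erasureProb φ) ^ 2 * n)) ≤ enoughProb φ n := by
  classical
  have h := sum_few_accepted_le h0 h1 hn
  have h2 : ∑ z : Received n, ∏ i, pairMass φ (z i) = 1 := by
    rw [sum_pi_prod fun _ => pairMass φ]
    simp [sum_pairMass]
  rw [sub_le_comm]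
  refine le_trans ?_ h
  rw [← h2, enoughProb, ← Finset.sum_sub_distrib]
  refine Finset.sum_le_sum fun z _ => ?_
  have hP : 0 ≤ ∏ i, pairMass φ (z i) := Finset.prod_nonneg fun i _ => pairMass_nonneg h0 h1 _
  by_cases hz : n ≤ (Finset.univ.filter fun i => isErased (z i) = false).card
  · rw [if_pos (goodHalves_nonempty hz), sub_self]
    split_ifs
    exacts [hP, le_rfl]
  · rw [if_pos (not_le.1 hz)]
    split_ifs <;> linarith

lemma Halving.part_not_erased {z : Received n} {I : Halving n} (hI : I ∈ goodHalves z)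
    (σ : Equiv.Perm (Fin n)) (j : Fin n) : isErased (I.part σ z j) = false := by
  have := mem_goodHalves.1 hI _ (I.index_mem σ j)
  simp [isErased, Halving.part, this]

/-- Only runs with a good half and a correctly recovered codeword are counted; hashing that codeword
gives the secret. The other half integrates to the mass of its received pairs. -/
lemma IsParityCheck.prob_correct_ge (h0 : 0 ≤ φ) (h1 : φ < 1 / 2) (h : IsParityCheck C H₀)
    (hwp : WellPosed H₀ H₁) (D : Bits n → Bits n) (wantsX : Bool) :
    enoughProb φ n * (1 - decodingError (flipProb φ) C D) ≤
      prob (runLaw φ H₀ H₁ (honestBob wantsX))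
        (fun ω => ω.output D H₁ wantsX = ω.wanted wantsX) := by
  classical
  have hp0 := flipProb_nonneg h1 (φ := φ)
  have hp1 := flipProb_lt_half h1
  have hd := one_sub_decodingError_nonneg (C := C) hp0 (by linarith) D
  set d := 1 - decodingError (flipProb φ) C D with hdd
  have hP0 : ∀ z : Received n, 0 ≤ ∏ i, pairMass φ (z i) := fun z =>
    Finset.prod_nonneg fun i _ => pairMass_nonneg h0 h1 _
  have hLHS : enoughProb φ n * d ≤ ∑ z : Received n, ∑ I, ∑ σ : Equiv.Perm (Fin n),
      ∑ τ : Equiv.Perm (Fin n), 1 / (n.factorial : ℝ) * (1 / (n.factorial : ℝ) *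
        ((if I ∈ goodHalves z then (honestHalf z I).toReal else 0) *
          ((∏ i, pairMass φ (z i)) * d))) := by
    simp_rw [sum_perm_perm]
    rw [enoughProb, Finset.sum_mul]
    refine Finset.sum_le_sum fun z _ => ?_
    rw [← Finset.sum_mul]
    split_ifs with hz
    · rw [sum_honestHalf_good z hz, one_mul]
    · rw [zero_mul]
      refine mul_nonneg (Finset.sum_nonneg fun I _ => ?_) (mul_nonneg (hP0 z) hd)
      split_ifs
      exacts [ENNReal.toReal_nonneg, le_rfl]
  refine hLHS.trans ?_
  let A : (Fin n → ZMod 2 × ZMod 2) → Bits m → Bits n → Bits n → ℝ := fun w u c r =>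
    if D (c + r + fun j => (w j).1) = c ∧ H₁.mulVec c = u then 1 else 0
  have hA : ∀ w u c r, 0 ≤ A w u c r := fun w u c r => by
    dsimp only [A]; split_ifs <;> norm_num
  cases wantsX
  · have key := sum_runLaw_mul φ H₀ H₁ (honestBob false) (fun _ _ _ _ _ _ _ => 1)
      (fun z I _ τ => A (I.swap.part τ z))
    have h2 : ∑ ω : Run n m, runLaw φ H₀ H₁ (honestBob false) ω *
        (1 * A (ω.I.swap.part ω.τ ω.z) ω.y ω.cy ω.rJ) ≤ prob (runLaw φ H₀ H₁ (honestBob false))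
        (fun ω => ω.output D H₁ false = ω.wanted false) := by
      refine Finset.sum_le_sum fun ω _ => ?_
      have h3 := runLaw_nonneg h0 h1 H₀ H₁ (honestBob false) ω
      by_cases h4 : D (ω.cy + ω.rJ + fun j => (ω.I.swap.part ω.τ ω.z j).1) = ω.cy ∧
          H₁.mulVec ω.cy = ω.y
      · rw [if_pos]
        · simp [A, h4]
        · change H₁.mulVec (D _) = ω.y
          exact (congrArg H₁.mulVec h4.1).trans h4.2
      · have : A (ω.I.swap.part ω.τ ω.z) ω.y ω.cy ω.rJ = 0 := if_neg h4
        rw [this, mul_zero, mul_zero]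
        split_ifs
        exacts [h3, le_rfl]
    refine le_trans ?_ (key.symm.le.trans h2)
    refine Finset.sum_le_sum fun z _ => ?_
    -- Bob decodes on `J` here, so the sum over good halves is reindexed by the exchange of the
    -- halves.
    rw [← Equiv.sum_comp (Halving.swapEquiv n)]
    refine Finset.sum_le_sum fun I _ => Finset.sum_le_sum fun σ _ => Finset.sum_le_sum fun τ _ => ?_
    rw [h.halfSum_one h1 hwp, honestBob_false_apply]
    change 1 / (n.factorial : ℝ) * (1 / (n.factorial : ℝ) *
        ((if I.swap ∈ goodHalves z then (honestHalf z I.swap).toReal else 0) *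
          ((∏ i, pairMass φ (z i)) * d))) ≤ _
    split_ifs with hI
    · rw [h.halfSum_decoded h1 hwp D _ (Halving.part_not_erased hI τ),
        I.prod_split σ τ fun i => pairMass φ (z i)]
      refine le_of_eq ?_
      simp only [Halving.part]
      ring
    · simp only [zero_mul, mul_zero]
      refine mul_nonneg (by positivity) (mul_nonneg (Finset.prod_nonneg fun j _ =>
        pairMass_nonneg h0 h1 _) (halfSum_nonneg h0 h1 H₀ H₁ _ (hA _)))
  · have key := sum_runLaw_mul φ H₀ H₁ (honestBob true)
      (fun z I σ _ => A (I.part σ z)) (fun _ _ _ _ _ _ _ => 1)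
    have h2 : ∑ ω : Run n m, runLaw φ H₀ H₁ (honestBob true) ω *
        (A (ω.I.part ω.σ ω.z) ω.x ω.cx ω.rI * 1) ≤ prob (runLaw φ H₀ H₁ (honestBob true))
        (fun ω => ω.output D H₁ true = ω.wanted true) := by
      refine Finset.sum_le_sum fun ω _ => ?_
      have h3 := runLaw_nonneg h0 h1 H₀ H₁ (honestBob true) ω
      by_cases h4 : D (ω.cx + ω.rI + fun j => (ω.I.part ω.σ ω.z j).1) = ω.cx ∧
          H₁.mulVec ω.cx = ω.x
      · rw [if_pos]
        · simp [A, h4]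
        · change H₁.mulVec (D _) = ω.x
          exact (congrArg H₁.mulVec h4.1).trans h4.2
      · have : A (ω.I.part ω.σ ω.z) ω.x ω.cx ω.rI = 0 := if_neg h4
        rw [this, zero_mul, mul_zero]
        split_ifs
        exacts [h3, le_rfl]
    refine le_trans ?_ (key.symm.le.trans h2)
    refine Finset.sum_le_sum fun z _ => ?_
    refine Finset.sum_le_sum fun I _ => Finset.sum_le_sum fun σ _ => Finset.sum_le_sum fun τ _ => ?_
    rw [h.halfSum_one h1 hwp, honestBob_true_apply]
    split_ifs with hI
    · rw [h.halfSum_decoded h1 hwp D _ (Halving.part_not_erased hI σ),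
        I.prod_split σ τ fun i => pairMass φ (z i)]
      refine le_of_eq ?_
      simp only [Halving.part]
      ring
    · simp only [zero_mul, mul_zero]
      refine mul_nonneg (by positivity) (mul_nonneg (halfSum_nonneg h0 h1 H₀ H₁ _ (hA _))
        (Finset.prod_nonneg fun j _ => pairMass_nonneg h0 h1 _))

end Correct

/-- Correctness for a capacity-achieving sequence of codes. -/
theorem correctForBob_of_capacityAchieving {φ : ℝ} (h0 : 0 ≤ φ) (h1 : φ < 1 / 2) {n : ℕ → ℕ}
    {C : ∀ i, Submodule (ZMod 2) (Bits (n i))} {D : ∀ i, Bits (n i) → Bits (n i)}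
    {H₀ : ∀ i, Matrix (Fin (n i - Module.finrank (ZMod 2) (C i))) (Fin (n i)) (ZMod 2)}
    (hH : ∀ i, IsParityCheck (C i) (H₀ i)) (hC : CapacityAchieving (flipProb φ) n C D)
    (m : ℕ → ℕ) : CorrectForBob φ n _ m H₀ D := by
  have hp0 := flipProb_nonneg h1 (φ := φ)
  have hp1 := flipProb_lt_half h1
  have hν : 0 < (1 / 2 - erasureProb φ) ^ 2 := by
    have := erasureProb_lt_half h1
    exact pow_pos (by linarith) 2
  refine ⟨fun i => decodingError (flipProb φ) (C i) (D i) +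
    Real.exp (-((1 / 2 - erasureProb φ) ^ 2 * n i)), ?_, fun i H₁ hwp wantsX => ?_⟩
  · have := hC.error.add ((Real.tendsto_exp_neg_atTop_nhds_zero.comp
      ((tendsto_natCast_atTop_atTop (R := ℝ)).const_mul_atTop hν)).comp hC.length)
    simpa using this
  · have hd0 := decodingError_nonneg (C := C i) hp0 (by linarith) (D i)
    have hd1 := one_sub_decodingError_nonneg (C := C i) hp0 (by linarith) (D i)
    set X := Real.exp (-((1 / 2 - erasureProb φ) ^ 2 * n i)) with hX
    have hX0 : 0 < X := Real.exp_pos _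
    rcases Nat.eq_zero_or_pos (n i) with hn | hn
    -- The Chernoff bound needs `n > 0`; for `n = 0` the claimed lower bound is not positive.
    · have : X = 1 := by rw [hX, hn]; simp
      refine le_trans (b := 0) (by linarith) ?_
      unfold prob
      refine Finset.sum_nonneg fun ω _ => ?_
      split_ifs
      exacts [runLaw_nonneg h0 h1 _ _ _ ω, le_rfl]
    · refine le_trans ?_ ((hH i).prob_correct_ge h0 h1 hwp (D i) wantsX)
      have := mul_le_mul_of_nonneg_right (enoughProb_ge h0 h1 hn) hd1
      rw [← hX] at this
      nlinarith

/-! ### What Alice observes -/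

section Hidden

variable {n : ℕ}

/-- The image of a half under a permutation of the indices. -/
def Halving.mapEquiv (π : Equiv.Perm (Fin (2 * n))) : Halving n ≃ Halving n :=
  π.finsetCongr.subtypeEquiv fun I => by simp [Equiv.finsetCongr]

lemma Halving.mem_mapEquiv (π : Equiv.Perm (Fin (2 * n))) (I : Halving n) (i : Fin (2 * n)) :
    i ∈ (Halving.mapEquiv π I : Finset (Fin (2 * n))) ↔ π.symm i ∈ (I : Finset (Fin (2 * n))) := by
  change i ∈ (I : Finset (Fin (2 * n))).map π.toEmbedding ↔ _
  rw [Finset.mem_map_equiv]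

/-- The permutation that exchanges the two halves of a partition. -/
noncomputable def Halving.exchange (I : Halving n) : Equiv.Perm (Fin (2 * n)) :=
  ((I.sumEquiv 1 1).symm.trans (Equiv.sumComm _ _)).trans (I.sumEquiv 1 1)

lemma Halving.exchange_symm_mem (I : Halving n) (i : Fin (2 * n)) :
    I.exchange.symm i ∈ (I : Finset (Fin (2 * n))) ↔ i ∉ (I : Finset (Fin (2 * n))) := by
  obtain ⟨j, rfl⟩ := (I.sumEquiv 1 1).surjective i
  have h : I.exchange.symm (I.sumEquiv 1 1 j) = I.sumEquiv 1 1 j.swap := by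
    simp [exchange]
  rw [h]
  rcases j with j | j
  · exact iff_of_false (I.swap_index_notMem 1 j) (not_not.2 (I.index_mem 1 j))
  · exact iff_of_true (I.index_mem 1 j) (I.swap_index_notMem 1 j)

lemma Halving.mapEquiv_exchange (I : Halving n) : Halving.mapEquiv I.exchange I = I.swap := by
  refine Subtype.ext (Finset.ext fun i => ?_)
  rw [Halving.mem_mapEquiv, I.exchange_symm_mem]
  exact Finset.mem_compl.symm

/-- The choice is uniform, on the good halves or on all of them, so it follows any bijection that
matches good halves with good halves. -/
lemma honestHalf_congr {z z' : Received n} (e : Halving n ≃ Halving n)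
    (h : ∀ J, J ∈ goodHalves z ↔ e J ∈ goodHalves z') (J : Halving n) :
    honestHalf z J = honestHalf z' (e J) := by
  classical
  have hmap : goodHalves z' = (goodHalves z).map e.toEmbedding := by
    ext K
    rw [Finset.mem_map_equiv, h, e.apply_symm_apply]
  have hcard : (goodHalves z').card = (goodHalves z).card := by rw [hmap, Finset.card_map]
  unfold honestHalf
  by_cases hz : (goodHalves z).Nonempty
  · have hz' : (goodHalves z').Nonempty := by rw [hmap]; exact hz.map
    rw [dif_pos hz, dif_pos hz']
    simp only [PMF.uniformOfFinset_apply, hcard, ← h J]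
    congr
  · have hz' : ¬ (goodHalves z').Nonempty := by rwa [hmap, Finset.map_nonempty]
    rw [dif_neg hz, dif_neg hz']
    simp [PMF.uniformOfFinset_apply]

/-- The noise on the channel, permuted. -/
def permuteNoise (r : Bits (2 * n)) (π : Equiv.Perm (Fin (2 * n))) : Received n ≃ Received n where
  toFun z := fun i => ((z (π i)).1 + (r (π i) + r i), (z (π i)).2 + (r (π i) + r i))
  invFun z := fun i => ((z (π.symm i)).1 + (r (π.symm i) + r i),
    (z (π.symm i)).2 + (r (π.symm i) + r i))
  left_inv z := by
    funext i
    have h : r i + r (π.symm i) + (r (π.symm i) + r i) = 0 := by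
      rw [add_comm (r i), add_self_zmod_two]
    ext <;> simp [add_assoc, h]
  right_inv z := by
    funext i
    have h : r i + r (π i) + (r (π i) + r i) = 0 := by
      rw [add_comm (r i), add_self_zmod_two]
    ext <;> simp [add_assoc, h]

lemma bsc_permuteNoise (φ : ℝ) (a b c : ZMod 2) : bsc φ a (b + (c + a)) = bsc φ c b := by
  have h : a = c + (c + a) := by rw [← add_assoc, add_self_zmod_two, zero_add]
  nth_rw 1 [h]
  exact bsc_add φ c b (c + a)

/-- With `r` fixed, exchanging the noise of the two halves preserves the channel law and transports
the good halves by a permutation that takes `I` to its complement. -/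
lemma sum_bsc_honest (φ : ℝ) (r : Bits (2 * n)) (I : Halving n) :
    ∑ z : Received n, (∏ i, bsc φ (r i) (z i).1 * bsc φ (r i) (z i).2) * (honestHalf z I).toReal =
      ∑ z : Received n, (∏ i, bsc φ (r i) (z i).1 * bsc φ (r i) (z i).2) *
        (honestHalf z I.swap).toReal := by
  rw [← Equiv.sum_comp (permuteNoise r I.exchange)]
  refine Finset.sum_congr rfl fun z _ => ?_
  congr 1
  · simp only [permuteNoise, Equiv.coe_fn_mk, bsc_permuteNoise]
    exact Equiv.prod_comp I.exchange fun i => bsc φ (r i) (z i).1 * bsc φ (r i) (z i).2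
  · rw [← I.mapEquiv_exchange]
    refine congrArg _ (honestHalf_congr _ (fun J => ?_) I)
    rw [mem_goodHalves, mem_goodHalves]
    constructor
    · intro h i hi
      have := h _ ((Halving.mem_mapEquiv _ _ _).1 hi)
      simpa [permuteNoise] using this
    · intro h i hi
      have := h (I.exchange i) ((Halving.mem_mapEquiv _ _ _).2 (by simpa using hi))
      simp [permuteNoise, this]

end Hidden

lemma prob_aliceView {a n m : ℕ} (φ : ℝ) (H₀ : Matrix (Fin a) (Fin n) (ZMod 2))
    (H₁ : Matrix (Fin m) (Fin n) (ZMod 2)) (bob : BobStrategy n) (x y : Bits m) (r : Bits (2 * n))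
    (I : Halving n) (σ τ : Equiv.Perm (Fin n)) (cx cy : Bits n) :
    prob (runLaw φ H₀ H₁ bob) (fun ω => ω.aliceView = (x, y, r, I, σ, τ, cx, cy)) =
      (∑ z : Received n, (∏ i, bsc φ (r i) (z i).1 * bsc φ (r i) (z i).2) *
        (bob z I).toReal) * ((1 / 2) ^ m * (1 / 2) ^ m * (1 / 2) ^ (2 * n) *
          (1 / (n.factorial : ℝ)) * (1 / (n.factorial : ℝ)) *
          pickProb H₀ H₁ x cx * pickProb H₀ H₁ y cy) := by
  classical
  let f : Received n → Run n m := fun z => ⟨x, y, r, z, I, σ, τ, cx, cy⟩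
  have hf : Function.Injective f := fun z z' h => congrArg Run.z h
  have himg : ∀ ω : Run n m, ω.aliceView = (x, y, r, I, σ, τ, cx, cy) ↔ ω ∈ Finset.univ.map ⟨f, hf⟩ := by
    intro ω
    simp only [Finset.mem_map, Finset.mem_univ, true_and, Function.Embedding.coeFn_mk]
    constructor
    · intro h
      obtain ⟨x', y', r', z, I', σ', τ', cx', cy'⟩ := ω
      simp only [Run.aliceView, Prod.mk.injEq] at h
      obtain ⟨rfl, rfl, rfl, rfl, rfl, rfl, rfl, rfl⟩ := h
      exact ⟨z, rfl⟩
    · rintro ⟨z, rfl⟩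
      rfl
  rw [prob_congr _ himg]
  unfold prob
  refine (Finset.sum_subset (Finset.subset_univ (Finset.univ.map ⟨f, hf⟩)) fun ω _ h =>
    if_neg h).symm.trans ?_
  rw [Finset.sum_map, Finset.sum_mul]
  refine Finset.sum_congr rfl fun z _ => ?_
  rw [if_pos (Finset.mem_map_of_mem _ (Finset.mem_univ z))]
  simp only [runLaw, Function.Embedding.coeFn_mk, f]
  ring

theorem hiddenFromAlice (φ : ℝ) (n a m : ℕ → ℕ)
    (H₀ : ∀ i, Matrix (Fin (a i)) (Fin (n i)) (ZMod 2)) : HiddenFromAlice φ n a m H₀ := by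
  intro i H₁ v
  obtain ⟨x, y, r, I, σ, τ, cx, cy⟩ := v
  refine (prob_aliceView φ (H₀ i) H₁ _ x y r I σ τ cx cy).trans
    (Eq.trans ?_ (prob_aliceView φ (H₀ i) H₁ _ x y r I σ τ cx cy).symm)
  refine congrArg (· * _) ?_
  have h := sum_bsc_honest φ r I
  exact h.trans (Finset.sum_congr rfl fun z _ => by rw [honestBob_false_apply])

/-! ### The maximal rate -/

lemma rateP0_eq (φ : ℝ) : rateP0 φ = φ * (1 - φ) * (1 - binEnt (flipProb φ)) := by
  unfold rateP0 flipProb erasureProb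
  rw [mul_assoc 2 φ]

lemma erasureProb_mul_eq (φ : ℝ) :
    erasureProb φ * (1 - binEnt (flipProb φ)) = 2 * rateP0 φ := by
  rw [rateP0_eq]; unfold erasureProb; ring

lemma continuous_rateP0 : Continuous rateP0 := by
  unfold rateP0 binEnt
  have h : ∀ φ : ℝ, 1 - 2 * φ * (1 - φ) ≠ 0 := fun φ => by nlinarith [sq_nonneg (1 - 2 * φ)]
  have h2 : Continuous fun φ : ℝ => φ ^ 2 / (1 - 2 * φ * (1 - φ)) :=
    Continuous.div (by fun_prop) (by fun_prop) h
  have h3 := Real.binEntropy_continuous.comp h2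
  have h4 : Continuous fun φ : ℝ => Real.binEntropy (φ ^ 2 / (1 - 2 * φ * (1 - φ))) := h3
  fun_prop

lemma binEntropy_odds {t : ℝ} (ht : 0 < t) :
    Real.binEntropy (t ^ 2 / (1 + t ^ 2)) =
      Real.log (1 + t ^ 2) - t ^ 2 / (1 + t ^ 2) * (2 * Real.log t) := by
  have h : 0 < 1 + t ^ 2 := by positivity
  have h1 : 1 - t ^ 2 / (1 + t ^ 2) = 1 / (1 + t ^ 2) := by field_simp; ring
  rw [Real.binEntropy_eq_negMulLog_add_negMulLog_one_sub, Real.negMulLog, Real.negMulLog, h1,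
    Real.log_div (by positivity) h.ne', Real.log_div one_ne_zero h.ne', Real.log_pow, Real.log_one]
  field_simp
  push_cast
  ring

/-- The rate in terms of the odds `t = φ / (1 - φ)`. -/
lemma log_two_mul_rateP0 {φ : ℝ} (h0 : 0 < φ) (h1 : φ < 1) :
    Real.log 2 * rateP0 φ = (φ / (1 - φ)) / (1 + φ / (1 - φ)) ^ 2 * (Real.log 2 -
      Real.binEntropy ((φ / (1 - φ)) ^ 2 / (1 + (φ / (1 - φ)) ^ 2))) := by
  have h2 : 0 < 1 - φ := by linarith
  have h3 : 0 < 1 - 2 * φ * (1 - φ) := by nlinarith [sq_nonneg (1 - 2 * φ)]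
  have h4 : (φ / (1 - φ)) ^ 2 / (1 + (φ / (1 - φ)) ^ 2) = φ ^ 2 / (1 - 2 * φ * (1 - φ)) := by
    have : 1 + (φ / (1 - φ)) ^ 2 = (1 - 2 * φ * (1 - φ)) / (1 - φ) ^ 2 := by field_simp; ring
    rw [this, div_pow]
    field_simp
  have h5 : (φ / (1 - φ)) / (1 + φ / (1 - φ)) ^ 2 = φ * (1 - φ) := by
    have : 1 + φ / (1 - φ) = 1 / (1 - φ) := by field_simp; ring
    rw [this]; field_simp
  rw [h4, h5, ← log_two_mul_one_sub_binEnt, rateP0]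
  ring

/-- `6/25` is `1/4` divided by `1 + 1/24`; the constant `2/49` is the bound `2 x / (x + 2) ≤ log (1
+ x)` at `x = 1/24`. -/
lemma log_six_div_twentyfive_le : Real.log (6 / 25) ≤ -2 * Real.log 2 - 2 / 49 := by
  have h := Real.le_log_one_add_of_nonneg (x := 1 / 24) (by norm_num)
  have h2 : Real.log (6 / 25) = -2 * Real.log 2 - Real.log (1 + 1 / 24) := by
    rw [show (6 / 25 : ℝ) = ((2 : ℝ) ^ 2)⁻¹ * (1 + 1 / 24)⁻¹ by norm_num,
      Real.log_mul (by norm_num) (by norm_num), Real.log_inv, Real.log_inv, Real.log_pow]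
    push_cast; ring
  rw [h2]
  norm_num at h ⊢
  linarith

lemma le_log_six_div_twentyfive : -2 * Real.log 2 - 1 / 24 ≤ Real.log (6 / 25) := by
  have h := Real.log_le_sub_one_of_pos (x := 1 + 1 / 24) (by norm_num)
  have h2 : Real.log (6 / 25) = -2 * Real.log 2 - Real.log (1 + 1 / 24) := by
    rw [show (6 / 25 : ℝ) = ((2 : ℝ) ^ 2)⁻¹ * (1 + 1 / 24)⁻¹ by norm_num,
      Real.log_mul (by norm_num) (by norm_num), Real.log_inv, Real.log_inv, Real.log_pow]
    push_cast; ring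
  rw [h2]
  linarith

/-- The upper bound for the rate for small odds: the logarithms are replaced by their tangents at
`t = 6 / 25`. -/
lemma rate_odds_lt_of_le {t : ℝ} (h0 : 0 < t) (h1 : t ≤ 12 / 25) :
    t / (1 + t) ^ 2 * (Real.log 2 - Real.binEntropy (t ^ 2 / (1 + t ^ 2))) <
      0.1085 * Real.log 2 := by
  have hL1 := Real.log_two_gt_d9
  have hL2 := Real.log_two_lt_d9
  have hy : 0 < 1 + t ^ 2 := by positivity
  have ht : Real.log t ≤ Real.log (6 / 25) + (t / (6 / 25) - 1) := by
    have := Real.log_le_sub_one_of_pos (show 0 < t / (6 / 25) by positivity)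
    rw [Real.log_div h0.ne' (by norm_num)] at this
    linarith
  have hlt := log_six_div_twentyfive_le
  -- This tangent is linear in `1 / (1 + t²)`, which keeps a single denominator; `661/625 = 1 +
  -- (6/25)²`.
  have hyl : Real.log (661 / 625) + 1 - (661 / 625) / (1 + t ^ 2) ≤ Real.log (1 + t ^ 2) := by
    have := Real.log_le_sub_one_of_pos (show 0 < (661 / 625) / (1 + t ^ 2) by positivity)
    rw [Real.log_div (by norm_num) hy.ne'] at this
    linarith
  have hy0 : 0.05598 ≤ Real.log (661 / 625) := by
    have h := Real.le_log_one_add_of_nonneg (x := 36 / 625) (by norm_num)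
    norm_num at h ⊢
    linarith
  have hlt' : Real.log t ≤ -2 * 0.6931471803 - 2 / 49 + (t / (6 / 25) - 1) := by linarith
  rw [binEntropy_odds h0, div_mul_eq_mul_div, div_lt_iff₀ (by positivity)]
  have e1 : Real.log 2 - (Real.log (1 + t ^ 2) - t ^ 2 / (1 + t ^ 2) * (2 * Real.log t)) ≤
      0.6931471808 - 0.05598 - 1 + (661 / 625) / (1 + t ^ 2) + t ^ 2 / (1 + t ^ 2) *
        (2 * (-2 * 0.6931471803 - 2 / 49 + (t / (6 / 25) - 1))) := by
    have := mul_le_mul_of_nonneg_left hlt' (show 0 ≤ t ^ 2 / (1 + t ^ 2) by positivity)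
    linarith
  have e2 := mul_le_mul_of_nonneg_left e1 h0.le
  refine e2.trans_lt ?_
  have e3 : 0.1085 * 0.6931471803 * (1 + t) ^ 2 ≤ 0.1085 * Real.log 2 * (1 + t) ^ 2 := by
    have : 0 ≤ (1 + t) ^ 2 := by positivity
    nlinarith
  refine lt_of_lt_of_le ?_ e3
  have e4 : t * (0.6931471808 - 0.05598 - 1 + (661 / 625) / (1 + t ^ 2) + t ^ 2 / (1 + t ^ 2) *
        (2 * (-2 * 0.6931471803 - 2 / 49 + (t / (6 / 25) - 1)))) =
      (t * ((0.6931471808 - 0.05598 - 1) * (1 + t ^ 2) + 661 / 625 + t ^ 2 *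
        (2 * (-2 * 0.6931471803 - 2 / 49 + (t / (6 / 25) - 1))))) / (1 + t ^ 2) := by
    field_simp
  rw [e4, div_lt_iff₀ hy]
  -- It remains to show that a quartic in `t` is positive. It nearly has a double zero at `t =
  -- 0.24056`; this quadratic is the approximate cofactor, nonnegative up to `t = 12/25`.
  have hquad : 0 ≤ 1.29 + 1.396 * t - 8.26 * t ^ 2 := by nlinarith
  nlinarith [mul_nonneg (sq_nonneg (t - 0.24056)) hquad, sq_nonneg (t - 0.24056)]

/-- Crude bounds suffice here: `t / (1 + t)² ≤ 1/4`, and the entropy is at least 0.41 nats since its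
argument lies between `1/6` and `1/2`. -/
lemma rate_odds_lt_of_ge {t : ℝ} (h0 : 12 / 25 ≤ t) (h1 : t ≤ 1) :
    t / (1 + t) ^ 2 * (Real.log 2 - Real.binEntropy (t ^ 2 / (1 + t ^ 2))) <
      0.1085 * Real.log 2 := by
  have hL1 := Real.log_two_gt_d9
  have hL2 := Real.log_two_lt_d9
  have hp1 : 1 / 6 ≤ t ^ 2 / (1 + t ^ 2) := by
    rw [div_le_div_iff₀ (by norm_num) (by positivity)]; nlinarith
  have hp2 : t ^ 2 / (1 + t ^ 2) ≤ 2⁻¹ := by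
    rw [div_le_iff₀ (by positivity)]; nlinarith
  have hmono := Real.binEntropy_strictMonoOn.monotoneOn (a := 1 / 6) (b := t ^ 2 / (1 + t ^ 2))
    ⟨by norm_num, hp1.trans hp2⟩ ⟨by positivity, hp2⟩ hp1
  have hH : 0.41 ≤ Real.binEntropy (1 / 6) := by
    have h3 : 1 ≤ Real.log 3 := by
      rw [Real.le_log_iff_exp_le (by norm_num)]
      have := Real.exp_one_lt_d9
      linarith
    have h5 := Real.le_log_one_add_of_nonneg (x := 1 / 5) (by norm_num)
    have h6 : Real.log (1 / 6) = -(Real.log 2 + Real.log 3) := by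
      rw [← Real.log_mul (by norm_num) (by norm_num), ← Real.log_inv]; norm_num
    have h7 : Real.log (1 - 1 / 6) = -Real.log (1 + 1 / 5) := by
      rw [← Real.log_inv]; norm_num
    rw [Real.binEntropy_eq_negMulLog_add_negMulLog_one_sub, Real.negMulLog, Real.negMulLog, h6, h7]
    norm_num at h5 ⊢
    linarith
  have hf : t / (1 + t) ^ 2 ≤ 1 / 4 := by
    rw [div_le_div_iff₀ (by positivity) (by norm_num)]
    nlinarith [sq_nonneg (1 - t)]
  have hf0 : 0 ≤ t / (1 + t) ^ 2 := by positivity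
  calc _ ≤ t / (1 + t) ^ 2 * 0.29 := mul_le_mul_of_nonneg_left (by linarith) hf0
    _ ≤ 1 / 4 * 0.29 := mul_le_mul_of_nonneg_right hf (by norm_num)
    _ < _ := by linarith

lemma rateP0_lt {φ : ℝ} (h0 : 0 < φ) (h1 : φ < 1 / 2) : rateP0 φ < 0.1085 := by
  have hL : 0 < Real.log 2 := Real.log_pos one_lt_two
  have h2 : 0 < 1 - φ := by linarith
  have ht0 : 0 < φ / (1 - φ) := by positivity
  have ht1 : φ / (1 - φ) ≤ 1 := by rw [div_le_one h2]; linarith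
  have h3 : Real.log 2 * rateP0 φ < 0.1085 * Real.log 2 := by
    rw [log_two_mul_rateP0 h0 (by linarith)]
    rcases le_total (φ / (1 - φ)) (12 / 25) with h | h
    · exact rate_odds_lt_of_le ht0 h
    · exact rate_odds_lt_of_ge h ht1
  nlinarith

/-- The odds of `6/31` are `6/25`, where the logarithm has been estimated. -/
lemma lt_rateP0 : 0.1075 < rateP0 (6 / 31) := by
  have hL1 := Real.log_two_gt_d9
  have hL2 := Real.log_two_lt_d9
  have hL : 0 < Real.log 2 := Real.log_pos one_lt_two
  have h := log_two_mul_rateP0 (φ := 6 / 31) (by norm_num) (by norm_num)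
  rw [show (6 / 31 : ℝ) / (1 - 6 / 31) = 6 / 25 by norm_num, binEntropy_odds (by norm_num)] at h
  have h2 := Real.log_le_sub_one_of_pos (x := 1 + (6 / 25) ^ 2) (by norm_num)
  have h3 := le_log_six_div_twentyfive
  norm_num at h h2 h3
  norm_num
  nlinarith

/-- The rate function has a maximum, of value about `0.108`. -/
theorem exists_isMaxOn_rateP0 : ∃ φ ∈ Set.Ioo (0 : ℝ) (1 / 2),
    IsMaxOn rateP0 (Set.Ioo 0 (1 / 2)) φ ∧ |rateP0 φ - 0.108| < 0.0005 := by
  -- The rate vanishes at both ends of the closed interval and exceeds 0.1075 at `6/31`, so the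
  -- maximum is attained inside.
  obtain ⟨x, hx, hmax⟩ := isCompact_Icc.exists_isMaxOn (s := Set.Icc (0 : ℝ) (1 / 2))
    ⟨0, by norm_num⟩ continuous_rateP0.continuousOn
  have h1 : rateP0 (6 / 31) ≤ rateP0 x := hmax (show (6 / 31 : ℝ) ∈ Set.Icc 0 (1 / 2) by norm_num)
  have h2 := lt_rateP0
  have hx0 : x ≠ 0 := by
    rintro rfl
    have : rateP0 0 = 0 := by simp [rateP0]
    rw [this] at h1
    norm_num at h2
    linarith
  have hx1 : x ≠ 1 / 2 := by
    rintro rfl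
    have : rateP0 (1 / 2) = 0 := by
      have h3 : binEnt 2⁻¹ = 1 := by
        unfold binEnt
        rw [Real.binEntropy_two_inv]
        exact div_self (Real.log_pos one_lt_two).ne'
      have h4 : (1 / 2 : ℝ) ^ 2 / (1 - 2 * (1 / 2) * (1 - 1 / 2)) = 2⁻¹ := by norm_num
      rw [rateP0, h4, h3, sub_self, mul_zero]
    rw [this] at h1
    norm_num at h2
    linarith
  have hx' : x ∈ Set.Ioo (0 : ℝ) (1 / 2) :=
    ⟨lt_of_le_of_ne hx.1 hx0.symm, lt_of_le_of_ne hx.2 hx1⟩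
  refine ⟨x, hx', hmax.on_subset Set.Ioo_subset_Icc_self, ?_⟩
  have h3 := rateP0_lt hx'.1 hx'.2
  rw [abs_lt]
  constructor <;> linarith

/-- Every rate below `rateP0 φ` is achieved with suitable lengths of the secrets. -/
lemma exists_lengths {φ : ℝ} (h0 : 0 ≤ φ) (h1 : φ < 1 / 2) {n : ℕ → ℕ}
    (hn : Tendsto n atTop atTop) {R : ℝ} (hR : R < rateP0 φ) :
    ∃ m : ℕ → ℕ, (∀ᶠ i in atTop, R < (2 * (m i : ℝ)) / (4 * (n i : ℝ))) ∧
      ∃ ε' : ℝ, 0 < ε' ∧ ∀ i, (m i : ℝ) ≤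
        (n i : ℝ) * erasureProb φ * (1 - binEnt (flipProb φ) - ε') := by
  have hx : 0 < 1 - binEnt (flipProb φ) := by linarith [binEnt_lt_one (flipProb_lt_half h1)]
  have hε := erasureProb_nonneg h0 h1
  have hε1 := erasureProb_lt_half h1
  set x := 1 - binEnt (flipProb φ) with hxdef
  have hR2 : 2 * R < erasureProb φ * x := by rw [erasureProb_mul_eq]; linarith
  -- The first bound keeps the length nonnegative. The second leaves, as `ε < 1/2`, a surplus of at
  -- least `n ε' / 2` over `2 R n`, which exceeds the rounding loss of 1 once `n > 2 / ε'`.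
  set ε' := min x (erasureProb φ * x - 2 * R) with hε'
  have hε'0 : 0 < ε' := lt_min hx (by linarith)
  have hε'x : ε' ≤ x := min_le_left _ _
  have hε'R : ε' ≤ erasureProb φ * x - 2 * R := min_le_right _ _
  have hnn : ∀ i, 0 ≤ (n i : ℝ) * erasureProb φ * (x - ε') := fun i =>
    mul_nonneg (mul_nonneg (Nat.cast_nonneg _) hε) (by linarith)
  refine ⟨fun i => ⌊(n i : ℝ) * erasureProb φ * (x - ε')⌋₊, ?_, ε', hε'0, fun i =>
    Nat.floor_le (hnn i)⟩
  have hbig := (tendsto_natCast_atTop_atTop (R := ℝ)).comp hn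
  filter_upwards [hbig.eventually (eventually_gt_atTop (2 / ε'))] with i hi
  simp only [Function.comp_apply] at hi
  have hn0 : (0 : ℝ) < n i := lt_trans (by positivity) hi
  rw [lt_div_iff₀ (by positivity)]
  have hfl := Nat.lt_floor_add_one ((n i : ℝ) * erasureProb φ * (x - ε'))
  rw [div_lt_iff₀ hε'0] at hi
  have h2 : (2 * R + ε') * n i ≤ erasureProb φ * x * n i :=
    mul_le_mul_of_nonneg_right (by linarith) hn0.le
  have h3 : erasureProb φ * (ε' * n i) ≤ 1 / 2 * (ε' * n i) :=
    mul_le_mul_of_nonneg_right hε1.le (by positivity)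
  nlinarith

end ObliviousTransfer

theorem mainTheorem7 :
    (∀ φ : ℝ, 0 ≤ φ → φ < 1 / 2 →
      ∀ (n : ℕ → ℕ) (C : ∀ i, Submodule (ZMod 2) (Bits (n i)))
        (D : ∀ i, Bits (n i) → Bits (n i))
        (H₀ : ∀ i, Matrix (Fin (n i - Module.finrank (ZMod 2) (C i))) (Fin (n i)) (ZMod 2)),
      (∀ i, IsParityCheck (C i) (H₀ i)) →
      CapacityAchieving (flipProb φ) n C D →
      (∀ ε' : ℝ, 0 < ε' → ∀ m : ℕ → ℕ,
        (∀ i, (m i : ℝ) ≤ (n i : ℝ) * erasureProb φ *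
          (1 - binEnt (flipProb φ) - ε')) →
        SecretFromBob φ n _ m H₀) ∧
      (∀ R : ℝ, R < rateP0 φ → ∃ m : ℕ → ℕ,
        (∀ᶠ i in atTop, R < (2 * (m i : ℝ)) / (4 * (n i : ℝ))) ∧
        SecretFromBob φ n _ m H₀ ∧
        CorrectForBob φ n _ m H₀ D ∧
        HiddenFromAlice φ n _ m H₀)) ∧
    (∃ φ ∈ Set.Ioo (0 : ℝ) (1 / 2),
      IsMaxOn rateP0 (Set.Ioo 0 (1 / 2)) φ ∧
      |rateP0 φ - 0.108| < 0.0005) := by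
  refine ⟨fun φ h0 h1 n C D H₀ hH hC => ⟨fun ε' hε' m hm =>
    secretFromBob_of_capacityAchieving h0 h1 hH hC hε' hm, fun R hR => ?_⟩, exists_isMaxOn_rateP0⟩
  obtain ⟨m, hmR, ε', hε', hm⟩ := exists_lengths h0 h1 hC.length hR
  exact ⟨m, hmR, secretFromBob_of_capacityAchieving h0 h1 hH hC hε' hm,
    correctForBob_of_capacityAchieving h0 h1 hH hC m, hiddenFromAlice φ n _ m H₀⟩
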